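/- Let $(S,\sigma)$ be a complete $n$-dimensional Riemannian manifold with volume measure $\mathcal H^n$ (the $n$-dimensional Hausdorff measure of the Riemannian distance). For a compact set $K\subset S$ and $t>0$, let $\mathcal L_t(K)$ be the set of all locally Lipschitz functions $\phi$ on $S$ with $0\le\phi\le t$ and $\phi|_K=t$ such that $\overline{\mathrm{spt}\,\phi\setminus K}$ is compact, and put $$\mathrm{cap}_t(K)=\inf_{\phi\in\mathcal L_t(K)}\int_S\left(\sqrt{1+|D\phi|^2}-1\right),\qquad \mathrm{cap}(K)=\inf_{\phi\in\mathcal L_1(K)}\int_S|D\phi|^2 .$$ $S$ is called parabolic if $\mathrm{cap}(K)=0$ for some compact $K\subset S$ with $\mathcal H^n(K)>0$, and $M$-parabolic if $\mathrm{cap}_t(K)=0$ for some $t>0$ and some compact $K\subset S$ with $\mathcal H^n(K)>0$. **Proposition.** For every integer $n\ge2$ there is a complete noncompact rotationally symmetric $n$-dimensional Riemannian manifold $S$, namely $\mathbb R^n$ with a smooth metric that has the form $dr^2+f(r)^2\,d\theta^2$ in polar coordinates, where $d\theta^2$ is the standard metric of the unit sphere $\mathbb S^{n-1}$ and $f$ is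 smooth on $[0,\infty)$ with $f(0)=0$, $f'(0)=1$ and $f>0$ on $(0,\infty)$, such that 1. $\mathrm{cap}(F)>0$ for every compact set $F\subset S$ with $\mathcal H^n(F)>0$, and 2. $\mathrm{cap}_t(F)=0$ for every $t>0$ and every compact set $F\subset S$. In particular, $S$ is $M$-parabolic but not parabolic. -/

import Mathlib

open Set MeasureTheory Bundle Manifold
open scoped ENNReal ContDiff Topology

noncomputable section

/-- Smooth Riemannian metrics on the manifold `ℝⁿ`. -/
abbrev SmoothMetric (n : ℕ) : Type :=
  ContMDiffRiemannianMetric 𝓘(ℝ, EuclideanSpace ℝ (Fin n)) ∞ (EuclideanSpace ℝ (Fin n))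
    (fun x : EuclideanSpace ℝ (Fin n) ↦ TangentSpace 𝓘(ℝ, EuclideanSpace ℝ (Fin n)) x)

namespace SmoothMetric

variable {n : ℕ}

/-- The scalar product `g_x(v, w)`, for tangent vectors written as elements of `ℝⁿ`. -/
def ip (g : SmoothMetric n) (x v w : EuclideanSpace ℝ (Fin n)) : ℝ := g.inner x v w

/-- `ℝⁿ` with the Riemannian distance of `g` (the infimum of the `g`-lengths of `C¹` paths). Its
topology is the usual one. -/
@[reducible] def metricSpace (g : SmoothMetric n) :
    PseudoEMetricSpace (EuclideanSpace ℝ (Fin n)) :=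
  letI : RiemannianBundle
      (fun x : EuclideanSpace ℝ (Fin n) ↦ TangentSpace 𝓘(ℝ, EuclideanSpace ℝ (Fin n)) x) :=
    ⟨g.toRiemannianMetric⟩
  haveI : IsContinuousRiemannianBundle (EuclideanSpace ℝ (Fin n))
      (fun x : EuclideanSpace ℝ (Fin n) ↦ TangentSpace 𝓘(ℝ, EuclideanSpace ℝ (Fin n)) x) :=
    ⟨⟨g.inner, g.contMDiff.continuous, fun _ _ _ ↦ rfl⟩⟩
  PseudoEMetricSpace.ofRiemannianMetric 𝓘(ℝ, EuclideanSpace ℝ (Fin n))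
    (EuclideanSpace ℝ (Fin n))

/-- `(ℝⁿ, g)` is complete, as a metric space with the Riemannian distance. -/
def IsComplete (g : SmoothMetric n) : Prop :=
  @CompleteSpace (EuclideanSpace ℝ (Fin n)) g.metricSpace.toUniformSpace

/-- `φ` is locally Lipschitz for the Riemannian distance of `g`. -/
def IsLocallyLipschitz (g : SmoothMetric n) (φ : EuclideanSpace ℝ (Fin n) → ℝ) : Prop :=
  @LocallyLipschitz (EuclideanSpace ℝ (Fin n)) ℝ g.metricSpace inferInstance φ

/-- `g` is rotationally symmetric: in polar coordinates `x = r θ`, `r > 0`, `θ ∈ S^{n-1}`, it is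
`dr² + f(r)² dθ²` with `f` smooth on `[0, ∞)`, `f(0) = 0`, `f'(0) = 1`, `f > 0` on `(0, ∞)`.
The differential of `(r, θ) ↦ r θ` sends `(a, v)`, with `a ∈ ℝ` and `v ⟂ θ` tangent to the sphere,
to `a θ + r v`. -/
def IsRotationallySymmetric (g : SmoothMetric n) : Prop :=
  ∃ f : ℝ → ℝ, ContDiffOn ℝ ∞ f (Ici 0) ∧ f 0 = 0 ∧ HasDerivWithinAt f 1 (Ici 0) 0 ∧
    (∀ r, 0 < r → 0 < f r) ∧
    ∀ (r : ℝ) (θ : EuclideanSpace ℝ (Fin n)), 0 < r → ‖θ‖ = 1 →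
      ∀ (a b : ℝ) (v w : EuclideanSpace ℝ (Fin n)), inner ℝ θ v = 0 → inner ℝ θ w = 0 →
        g.ip (r • θ) (a • θ + r • v) (b • θ + r • w) = a * b + f r ^ 2 * inner ℝ v w

/-- The matrix `(g_ij)` of `g` at `x` in the standard coordinates of `ℝⁿ`. -/
def gram (g : SmoothMetric n) (x : EuclideanSpace ℝ (Fin n)) : Matrix (Fin n) (Fin n) ℝ :=
  Matrix.of fun i j ↦ g.ip x (EuclideanSpace.single i 1) (EuclideanSpace.single j 1)

/-- The Riemannian volume measure `√(det g_ij) dx` of `g`, which is the `n`-dimensional Hausdorff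
measure (with its usual normalization) of the Riemannian distance. -/
def vol (g : SmoothMetric n) : Measure (EuclideanSpace ℝ (Fin n)) :=
  volume.withDensity fun x ↦ ENNReal.ofReal (√(g.gram x).det)

/-- The length `|Dφ|` of the `g`-gradient of `φ` at `x`, as the largest derivative of `φ` at `x`
along a vector of `g`-length at most one. A locally Lipschitz function is differentiable almost
everywhere; the value is `0` at the other points. -/
def gradNorm (g : SmoothMetric n) (φ : EuclideanSpace ℝ (Fin n) → ℝ)
    (x : EuclideanSpace ℝ (Fin n)) : ℝ :=
  sSup {s : ℝ | ∃ v : EuclideanSpace ℝ (Fin n), g.ip x v v ≤ 1 ∧ s = fderiv ℝ φ x v}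

/-- The class `ℒ_t(K, Ω)`: locally Lipschitz `φ` on the whole manifold with `0 ≤ φ ≤ t`, `φ = t` on
`K`, such that the closure of `spt φ \ K` is a compact subset of `Ω`. -/
def competitors (g : SmoothMetric n) (t : ℝ) (K Ω : Set (EuclideanSpace ℝ (Fin n))) :
    Set (EuclideanSpace ℝ (Fin n) → ℝ) :=
  {φ | g.IsLocallyLipschitz φ ∧ IsCompact (closure (tsupport φ \ K)) ∧
    closure (tsupport φ \ K) ⊆ Ω ∧ (∀ x, 0 ≤ φ x ∧ φ x ≤ t) ∧ ∀ x ∈ K, φ x = t}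

/-- `cap_t(K, Ω) = inf_{φ ∈ ℒ_t(K, Ω)} ∫_Ω (√(1 + |Dφ|²) - 1)`. -/
def capT (g : SmoothMetric n) (t : ℝ) (K Ω : Set (EuclideanSpace ℝ (Fin n))) : ℝ≥0∞ :=
  ⨅ φ ∈ g.competitors t K Ω,
    ∫⁻ x in Ω, ENNReal.ofReal (√(1 + g.gradNorm φ x ^ 2) - 1) ∂g.vol

/-- The classical capacity `cap(K, Ω) = inf_{φ ∈ ℒ_1(K, Ω)} ∫_Ω |Dφ|²`. -/
def cap (g : SmoothMetric n) (K Ω : Set (EuclideanSpace ℝ (Fin n))) : ℝ≥0∞ :=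
  ⨅ φ ∈ g.competitors 1 K Ω, ∫⁻ x in Ω, ENNReal.ofReal (g.gradNorm φ x ^ 2) ∂g.vol

/-- `(ℝⁿ, g)` is parabolic: `cap(K) = 0` for some compact `K` of positive volume. -/
def IsParabolic (g : SmoothMetric n) : Prop :=
  ∃ K : Set (EuclideanSpace ℝ (Fin n)), IsCompact K ∧ 0 < g.vol K ∧ g.cap K univ = 0

/-- `(ℝⁿ, g)` is M-parabolic: `cap_t(F) = 0` for some `t > 0` and some compact `F` of positive
volume. -/
def IsMParabolic (g : SmoothMetric n) : Prop :=
  ∃ t : ℝ, 0 < t ∧ ∃ F : Set (EuclideanSpace ℝ (Fin n)),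
    IsCompact F ∧ 0 < g.vol F ∧ g.capT t F univ = 0

end SmoothMetric

end

/-! ### The profile and the smooth bilinear form -/

noncomputable section

/-! With `f(r)² = r² H(r²)`, the sphere of radius `r` has area proportional to `f(r)^(n-1)`. The two
capacities see this function differently, and the profile is built to separate them.

For `cap_t`: since `√(1 + p²) - 1 ≤ p`, the integrand grows only linearly in the gradient, so a
radial ramp from `t` to `0` over a very thin annulus costs about `t` times the area of one sphere.
At `r = √m` the sine vanishes and `f(r)² = m / (1 + m)²`, so these areas tend to `0` and `cap_t`
vanishes (`capT_rotMetric_le`, `capT_rotMetric_eq_zero`).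

For `cap`: along a ray on which `φ` drops from `1` to `0`, Cauchy-Schwarz bounds the weighted energy
`∫ f^(n-1) φ'²` below by `1 / ∫ f^(1-n)`. The dips of `f` are so narrow that `∫ f^(1-n)` converges
at infinity: in `s = r²`, the integrand is at most a constant times `s⁻² |sin πs|^(-1/2)`, which has
integrable singularities at the integers and summable integrals between them
(`lintegral_inv_rotArea_lt_top`). Integration over the directions whose rays meet `F` bounds the
capacity below (`le_cap_rotMetric`), and these directions have positive measure when `F` has
positive volume, once a small ball about the origin is removed (`cap_rotMetric_pos`). -/

/-- The profile `H`: the metric has `f(r)² = r² H(r²)`. It is large except near the integers, where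
it dips to `1 / (1 + s)²`. -/
def rotProfile (n : ℕ) (s : ℝ) : ℝ :=
  (1 + s ^ (2 * n + 6) * Real.sin (Real.pi * s) ^ 2) / (1 + s) ^ 2

/-- The smooth function `(1 - H(s)) / s`. -/
def rotDefect (n : ℕ) (s : ℝ) : ℝ :=
  (s + 2 - s ^ (2 * n + 5) * Real.sin (Real.pi * s) ^ 2) / (1 + s) ^ 2

lemma rotProfile_eq (n : ℕ) {s : ℝ} (hs : 0 ≤ s) : rotProfile n s = 1 - s * rotDefect n s := by
  have : 1 + s ≠ 0 := by positivity
  unfold rotProfile rotDefect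
  field_simp
  ring

lemma rotProfile_pos (n : ℕ) {s : ℝ} (hs : 0 ≤ s) : 0 < rotProfile n s := by
  unfold rotProfile
  positivity

/-- The Euclidean scalar product as a bilinear form over `ℝ`. -/
def euclForm (n : ℕ) :
    EuclideanSpace ℝ (Fin n) →L[ℝ] EuclideanSpace ℝ (Fin n) →L[ℝ] ℝ := innerSL ℝ

@[simp] lemma euclForm_apply (n : ℕ) (v w : EuclideanSpace ℝ (Fin n)) :
    euclForm n v w = inner ℝ v w := rfl

/-- The form `H(|x|²) ⟨v, w⟩ + (1 - H(|x|²)) / |x|² ⟨x, v⟩ ⟨x, w⟩`, which is `dr² + r² H(r²) dθ²` in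
polar coordinates. -/
def rotForm (n : ℕ) (x : EuclideanSpace ℝ (Fin n)) :
    EuclideanSpace ℝ (Fin n) →L[ℝ] EuclideanSpace ℝ (Fin n) →L[ℝ] ℝ :=
  rotProfile n (‖x‖ ^ 2) • euclForm n +
    rotDefect n (‖x‖ ^ 2) • (euclForm n x).smulRight (euclForm n x)

lemma rotForm_apply (n : ℕ) (x v w : EuclideanSpace ℝ (Fin n)) :
    rotForm n x v w = rotProfile n (‖x‖ ^ 2) * inner ℝ v w +
      rotDefect n (‖x‖ ^ 2) * (inner ℝ x v * inner ℝ x w) := by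
  simp [rotForm]

lemma contDiff_rotForm (n : ℕ) : ContDiff ℝ ∞ (rotForm n) := by
  have h1 : ∀ x : EuclideanSpace ℝ (Fin n), (1 + ‖x‖ ^ 2) ^ 2 ≠ 0 := fun x ↦ by positivity
  have hs : ContDiff ℝ ∞ fun x : EuclideanSpace ℝ (Fin n) ↦ ‖x‖ ^ 2 := contDiff_norm_sq ℝ
  have hsin : ContDiff ℝ ∞ fun x : EuclideanSpace ℝ (Fin n) ↦
      Real.sin (Real.pi * ‖x‖ ^ 2) := Real.contDiff_sin.comp (contDiff_const.mul hs)
  have hp : ContDiff ℝ ∞ fun x : EuclideanSpace ℝ (Fin n) ↦ rotProfile n (‖x‖ ^ 2) :=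
    ContDiff.div (contDiff_const.add ((hs.pow _).mul (hsin.pow 2)))
      ((contDiff_const.add hs).pow 2) h1
  have hd : ContDiff ℝ ∞ fun x : EuclideanSpace ℝ (Fin n) ↦ rotDefect n (‖x‖ ^ 2) :=
    ContDiff.div ((hs.add contDiff_const).sub ((hs.pow _).mul (hsin.pow 2)))
      ((contDiff_const.add hs).pow 2) h1
  refine contDiff_clm_apply_iff.2 fun v ↦ contDiff_clm_apply_iff.2 fun w ↦ ?_
  simp only [rotForm_apply]
  exact (hp.mul contDiff_const).add
    (hd.mul ((contDiff_id.inner ℝ contDiff_const).mul (contDiff_id.inner ℝ contDiff_const)))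

/-- The radial function has gradient of `g`-length one: with `s = ‖x‖²`, the identity `H + s D = 1`
for the profile `H` and the defect `D` gives `s g(v, v) = ⟨x, v⟩² + H (s ‖v‖² - ⟨x, v⟩²)`, and the
last term is nonnegative. -/
lemma inner_sq_le_rotForm (n : ℕ) (x v : EuclideanSpace ℝ (Fin n)) :
    (inner ℝ x v) ^ 2 ≤ ‖x‖ ^ 2 * rotForm n x v v := by
  have hs : 0 ≤ ‖x‖ ^ 2 := by positivity
  have h := rotProfile_eq n hs
  have hp := rotProfile_pos n hs
  have hcs : (inner ℝ x v) ^ 2 ≤ ‖x‖ ^ 2 * ‖v‖ ^ 2 := by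
    rw [← mul_pow, ← sq_abs]
    gcongr
    exact abs_real_inner_le_norm x v
  rw [rotForm_apply, real_inner_self_eq_norm_sq]
  nlinarith [mul_nonneg hp.le (sub_nonneg.2 hcs)]

/-- For `x ≠ 0` the eigenvalues of the form are `1` along `x` and `H` on the orthogonal complement.
-/
lemma min_rotProfile_mul_le_rotForm (n : ℕ) (x v : EuclideanSpace ℝ (Fin n)) :
    min (rotProfile n (‖x‖ ^ 2)) 1 * ‖v‖ ^ 2 ≤ rotForm n x v v := by
  rcases eq_or_ne x 0 with rfl | hx
  · rw [rotForm_apply, real_inner_self_eq_norm_sq]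
    simp only [inner_zero_left, mul_zero, add_zero]
    gcongr
    exact min_le_left _ _
  have hs : 0 < ‖x‖ ^ 2 := by positivity
  have h := rotProfile_eq n hs.le
  have hp := rotProfile_pos n hs.le
  have hcs : (inner ℝ x v) ^ 2 ≤ ‖x‖ ^ 2 * ‖v‖ ^ 2 := by
    rw [← mul_pow, ← sq_abs]
    gcongr
    exact abs_real_inner_le_norm x v
  have h1 := min_le_left (rotProfile n (‖x‖ ^ 2)) 1
  have h2 := min_le_right (rotProfile n (‖x‖ ^ 2)) 1
  set m := min (rotProfile n (‖x‖ ^ 2)) 1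
  rw [← mul_le_mul_iff_right₀ hs, rotForm_apply, real_inner_self_eq_norm_sq]
  nlinarith [mul_nonneg (sub_nonneg.2 h1) (sub_nonneg.2 hcs),
    mul_nonneg (sub_nonneg.2 h2) (sq_nonneg (inner ℝ x v))]

lemma rotForm_le (n : ℕ) (x v : EuclideanSpace ℝ (Fin n)) :
    rotForm n x v v ≤ (rotProfile n (‖x‖ ^ 2) + 1) * ‖v‖ ^ 2 := by
  rcases eq_or_ne x 0 with rfl | hx
  · rw [rotForm_apply, real_inner_self_eq_norm_sq]
    simp only [inner_zero_left, mul_zero, add_zero]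
    nlinarith [sq_nonneg ‖v‖]
  have hs : 0 < ‖x‖ ^ 2 := by positivity
  have h := rotProfile_eq n hs.le
  have hp := rotProfile_pos n hs.le
  have hcs : (inner ℝ x v) ^ 2 ≤ ‖x‖ ^ 2 * ‖v‖ ^ 2 := by
    rw [← mul_pow, ← sq_abs]
    gcongr
    exact abs_real_inner_le_norm x v
  rw [← mul_le_mul_iff_right₀ hs, rotForm_apply, real_inner_self_eq_norm_sq]
  nlinarith [mul_nonneg hp.le (sq_nonneg (inner ℝ x v))]

lemma rotForm_pos (n : ℕ) (x : EuclideanSpace ℝ (Fin n)) {v : EuclideanSpace ℝ (Fin n)}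
    (hv : v ≠ 0) : 0 < rotForm n x v v := by
  have hp := rotProfile_pos n (sq_nonneg ‖x‖)
  refine lt_of_lt_of_le ?_ (min_rotProfile_mul_le_rotForm n x v)
  positivity

lemma isVonNBounded_rotForm (n : ℕ) (x : EuclideanSpace ℝ (Fin n)) :
    Bornology.IsVonNBounded ℝ {v : EuclideanSpace ℝ (Fin n) | rotForm n x v v < 1} := by
  have hp : 0 < min (rotProfile n (‖x‖ ^ 2)) 1 :=
    lt_min (rotProfile_pos n (sq_nonneg ‖x‖)) one_pos
  rw [NormedSpace.isVonNBounded_iff, isBounded_iff_forall_norm_le]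
  refine ⟨√(1 / min (rotProfile n (‖x‖ ^ 2)) 1), fun v hv ↦ Real.le_sqrt_of_sq_le ?_⟩
  rw [le_div_iff₀ hp, mul_comm]
  exact (min_rotProfile_mul_le_rotForm n x v).trans hv.le

lemma rotForm_symm (n : ℕ) (x v w : EuclideanSpace ℝ (Fin n)) :
    rotForm n x v w = rotForm n x w v := by
  rw [rotForm_apply, rotForm_apply, real_inner_comm]
  ring

/-- `rotForm` as a section of the bundle of bilinear forms on the tangent spaces. -/
def rotSection (n : ℕ) (x : EuclideanSpace ℝ (Fin n)) :
    TangentSpace 𝓘(ℝ, EuclideanSpace ℝ (Fin n)) x →L[ℝ]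
      TangentSpace 𝓘(ℝ, EuclideanSpace ℝ (Fin n)) x →L[ℝ] ℝ := rotForm n x

lemma contMDiff_rotSection (n : ℕ) : ContMDiff 𝓘(ℝ, EuclideanSpace ℝ (Fin n))
    (𝓘(ℝ, EuclideanSpace ℝ (Fin n)).prod 𝓘(ℝ, EuclideanSpace ℝ (Fin n) →L[ℝ]
      EuclideanSpace ℝ (Fin n) →L[ℝ] ℝ)) ∞
    (fun b ↦ TotalSpace.mk' (EuclideanSpace ℝ (Fin n) →L[ℝ] EuclideanSpace ℝ (Fin n) →L[ℝ] ℝ)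
      (E := fun x ↦ TangentSpace 𝓘(ℝ, EuclideanSpace ℝ (Fin n)) x →L[ℝ]
      TangentSpace 𝓘(ℝ, EuclideanSpace ℝ (Fin n)) x →L[ℝ] ℝ) b (rotSection n b)) := by
  intro x
  rw [contMDiffAt_section]
  have h := (contDiff_rotForm n).contMDiff x
  convert! h using 1
  ext y v w
  rw [hom_trivializationAt_apply]
  refine (inCoordinates_apply_eq₂ (F₃ := ℝ) (E₃ := Bundle.Trivial (EuclideanSpace ℝ (Fin n)) ℝ)
    (ϕ := rotSection n y) (v := v) (w := w) (mem_univ _) (mem_univ _) (mem_univ _)).trans ?_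
  -- The tangent bundle of a model space is trivialized by the identity, so in coordinates the
  -- section is `rotForm` itself.
  have h1 (u : EuclideanSpace ℝ (Fin n)) : (trivializationAt (EuclideanSpace ℝ (Fin n))
      (TangentSpace 𝓘(ℝ, EuclideanSpace ℝ (Fin n))) x).symm y u = u := by
    have h := congrArg (fun L : EuclideanSpace ℝ (Fin n) →L[ℝ] EuclideanSpace ℝ (Fin n) ↦ L u)
      (TangentBundle.symmL_model_space (𝕜 := ℝ) x y)
    exact (Trivialization.symmL_apply _ (mem_univ _) u).symm.trans h
  simp only [Trivial.fiberBundle_trivializationAt', Trivial.linearMapAt_trivialization,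
    LinearMap.id_coe, id_eq]
  rw [h1, h1]
  rfl

/-- The metric `dr² + r² H(r²) dθ²` on `ℝⁿ`. -/
def rotMetric (n : ℕ) : SmoothMetric n where
  inner x := rotSection n x
  symm x v w := rotForm_symm n x v w
  pos x _ hv := rotForm_pos n x hv
  isVonNBounded x := isVonNBounded_rotForm n x
  contMDiff := contMDiff_rotSection n

lemma rotMetric_ip (n : ℕ) (x v w : EuclideanSpace ℝ (Fin n)) :
    (rotMetric n).ip x v w = rotForm n x v w := rfl

/-! ### Riemannian and Euclidean distance, completeness -/

namespace SmoothMetric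
variable {n : ℕ}

/-- A `C¹` function with gradient of length at most one is `1`-Lipschitz for the Riemannian
distance. -/
lemma edist_le_edist_metricSpace (g : SmoothMetric n) {ρ : EuclideanSpace ℝ (Fin n) → ℝ}
    (hρ : ContDiff ℝ 1 ρ) (h : ∀ x v, fderiv ℝ ρ x v ^ 2 ≤ g.ip x v v)
    (x y : EuclideanSpace ℝ (Fin n)) : edist (ρ x) (ρ y) ≤ g.metricSpace.edist x y := by
  let : RiemannianBundle
      (fun x : EuclideanSpace ℝ (Fin n) ↦ TangentSpace 𝓘(ℝ, EuclideanSpace ℝ (Fin n)) x) :=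
    ⟨g.toRiemannianMetric⟩
  have hn (z : EuclideanSpace ℝ (Fin n))
      (v : TangentSpace 𝓘(ℝ, EuclideanSpace ℝ (Fin n)) z) :
      ‖v‖ₑ = ENNReal.ofReal √(g.ip z v v) := by
    rw [← ofReal_norm, norm_eq_sqrt_real_inner]
    rfl
  change _ ≤ riemannianEDist 𝓘(ℝ, EuclideanSpace ℝ (Fin n)) x y
  refine le_of_forall_gt fun r hr ↦ ?_
  obtain ⟨γ, γ0, γ1, γs, hγ⟩ := exists_lt_of_riemannianEDist_lt hr
  rw [contMDiffOn_iff_contDiffOn] at γs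
  refine lt_of_le_of_lt ?_ hγ
  rw [pathELength_eq_lintegral_mfderivWithin_Icc, ← γ0, ← γ1, edist_comm, edist_eq_enorm_sub]
  refine (enorm_sub_le_lintegral_derivWithin_Icc_of_contDiffOn_Icc (f := ρ ∘ γ)
    (hρ.comp_contDiffOn γs) zero_le_one).trans ?_
  refine setLIntegral_mono' measurableSet_Icc fun t ht ↦ ?_
  have hu : UniqueDiffWithinAt ℝ (Icc (0 : ℝ) 1) t := uniqueDiffOn_Icc zero_lt_one t ht
  have hd : derivWithin (ρ ∘ γ) (Icc 0 1) t =
      fderiv ℝ ρ (γ t) (fderivWithin ℝ γ (Icc 0 1) t 1) := by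
    rw [← fderivWithin_derivWithin, fderiv_comp_fderivWithin t
      (hρ.differentiable one_ne_zero _) (γs.differentiableOn one_ne_zero t ht) hu]
    rfl
  rw [hd, mfderivWithin_eq_fderivWithin, ← ofReal_norm]
  refine le_trans ?_ (hn (γ t) (fderivWithin ℝ γ (Icc 0 1) t 1)).ge
  exact ENNReal.ofReal_le_ofReal (Real.abs_le_sqrt (h _ _))

/-- The Riemannian distance is bounded by the Euclidean one where the metric is. -/
lemma metricSpace_edist_le (g : SmoothMetric n) {s : Set (EuclideanSpace ℝ (Fin n))}
    (hs : Convex ℝ s) {C : NNReal} (h : ∀ z ∈ s, ∀ v, g.ip z v v ≤ (C * ‖v‖) ^ 2)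
    {x y : EuclideanSpace ℝ (Fin n)} (hx : x ∈ s) (hy : y ∈ s) :
    g.metricSpace.edist x y ≤ C * edist x y := by
  let : RiemannianBundle
      (fun x : EuclideanSpace ℝ (Fin n) ↦ TangentSpace 𝓘(ℝ, EuclideanSpace ℝ (Fin n)) x) :=
    ⟨g.toRiemannianMetric⟩
  have : IsContinuousRiemannianBundle (EuclideanSpace ℝ (Fin n))
      (fun x : EuclideanSpace ℝ (Fin n) ↦ TangentSpace 𝓘(ℝ, EuclideanSpace ℝ (Fin n)) x) :=
    ⟨⟨g.inner, g.contMDiff.continuous, fun _ _ _ ↦ rfl⟩⟩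
  have hn (z : EuclideanSpace ℝ (Fin n))
      (v : TangentSpace 𝓘(ℝ, EuclideanSpace ℝ (Fin n)) z) :
      ‖v‖ₑ = ENNReal.ofReal √(g.ip z v v) := by
    rw [← ofReal_norm, norm_eq_sqrt_real_inner]
    rfl
  change riemannianEDist 𝓘(ℝ, EuclideanSpace ℝ (Fin n)) x y ≤ _
  let η := ContinuousAffineMap.lineMap (R := ℝ) x y
  refine (riemannianEDist_le_pathELength (γ := η) (a := 0) (b := 1) ?_ ?_ ?_ zero_le_one).trans ?_
  · rw [contMDiffOn_iff_contDiffOn]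
    exact η.contDiff.contDiffOn
  · simp [η, ContinuousAffineMap.coe_lineMap_eq]
  · simp [η, ContinuousAffineMap.coe_lineMap_eq]
  rw [← lintegral_fderiv_lineMap_eq_edist, pathELength_eq_lintegral_mfderivWithin_Icc,
    ← lintegral_const_mul' _ _ ENNReal.coe_ne_top]
  refine setLIntegral_mono' measurableSet_Icc fun t ht ↦ ?_
  have hz : η t ∈ s := by
    refine hs.segment_subset hx hy ?_
    rw [segment_eq_image_lineMap]
    exact ⟨t, ht, by simp [η, ContinuousAffineMap.coe_lineMap_eq]⟩
  rw [mfderivWithin_eq_fderivWithin]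
  refine (hn (η t) (fderivWithin ℝ η (Icc 0 1) t 1)).le.trans ?_
  rw [← ofReal_norm, ← ENNReal.ofReal_coe_nnreal, ← ENNReal.ofReal_mul C.coe_nonneg]
  exact ENNReal.ofReal_le_ofReal (Real.sqrt_le_iff.2 ⟨by positivity, h _ hz _⟩)

/-- A function that is Lipschitz for the Riemannian distance of `g` near every point is so for
the Euclidean distance. -/
lemma IsLocallyLipschitz.locallyLipschitz {g : SmoothMetric n}
    (hg : ∀ x : EuclideanSpace ℝ (Fin n), ∃ C : NNReal, ∀ z ∈ Metric.ball x 1, ∀ v,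
      g.ip z v v ≤ (C * ‖v‖) ^ 2)
    {φ : EuclideanSpace ℝ (Fin n) → ℝ} (hφ : g.IsLocallyLipschitz φ) : LocallyLipschitz φ := by
  intro x
  obtain ⟨K, t, ht, hK⟩ := hφ x
  obtain ⟨C, hC⟩ := hg x
  obtain ⟨r, hr, hrt⟩ := Metric.mem_nhds_iff.1 (show t ∈ 𝓝 x from ht)
  refine ⟨K * C, Metric.ball x (min r 1), Metric.ball_mem_nhds x (by positivity), ?_⟩
  intro y hy z hz
  have hs := Metric.ball_subset_ball (x := x) (min_le_left r 1)
  refine (hK (hrt (hs hy)) (hrt (hs hz))).trans ?_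
  rw [ENNReal.coe_mul, mul_assoc]
  gcongr
  exact g.metricSpace_edist_le (convex_ball x (min r 1))
    (fun w hw ↦ hC w (Metric.ball_subset_ball (min_le_right r 1) hw)) hy hz

end SmoothMetric

lemma hasFDerivAt_sqrt_add_norm_sq {E : Type*} [NormedAddCommGroup E] [InnerProductSpace ℝ E]
    {ε : ℝ} (x : E) (hx : ε + ‖x‖ ^ 2 ≠ 0) :
    HasFDerivAt (fun y : E ↦ √(ε + ‖y‖ ^ 2))
      ((1 / (2 * √(ε + ‖x‖ ^ 2))) • (2 • innerSL ℝ x)) x :=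
  HasFDerivAt.sqrt ((hasStrictFDerivAt_norm_sq x).hasFDerivAt.const_add ε) hx

/-- The norm is not differentiable at the origin, so the bound is proved for `√(ε + ‖x‖²)` and
passed to the limit `ε → 0`. -/
lemma edist_norm_le_edist_rotMetric (n : ℕ) (x y : EuclideanSpace ℝ (Fin n)) :
    edist ‖x‖ ‖y‖ ≤ (rotMetric n).metricSpace.edist x y := by
  have h (ε : ℝ) (hε : 0 < ε) :
      edist √(ε + ‖x‖ ^ 2) √(ε + ‖y‖ ^ 2) ≤ (rotMetric n).metricSpace.edist x y := by
    refine (rotMetric n).edist_le_edist_metricSpace (ρ := fun z ↦ √(ε + ‖z‖ ^ 2)) ?_ ?_ x y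
    · exact (contDiff_const.add (contDiff_norm_sq ℝ)).sqrt fun z ↦ by positivity
    · intro z v
      rw [(hasFDerivAt_sqrt_add_norm_sq z (by positivity)).fderiv, rotMetric_ip]
      have h1 : 0 < ε + ‖z‖ ^ 2 := by positivity
      have h2 : (((1 / (2 * √(ε + ‖z‖ ^ 2))) • (2 • innerSL ℝ z)) v) ^ 2 =
          inner ℝ z v ^ 2 / (ε + ‖z‖ ^ 2) := by
        simp only [smul_apply, innerSL_apply_apply, smul_eq_mul, nsmul_eq_mul]
        push_cast
        field_simp
        rw [Real.sq_sqrt h1.le]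
      rw [h2, div_le_iff₀ h1]
      rcases eq_or_ne v 0 with rfl | hv
      · simp
      · nlinarith [inner_sq_le_rotForm n z v, rotForm_pos n z hv]
  have hc (z : EuclideanSpace ℝ (Fin n)) :
      Filter.Tendsto (fun ε : ℝ ↦ √(ε + ‖z‖ ^ 2)) (𝓝[>] 0) (𝓝 ‖z‖) := by
    have : Continuous fun ε : ℝ ↦ √(ε + ‖z‖ ^ 2) := by fun_prop
    simpa using (this.tendsto 0).mono_left nhdsWithin_le_nhds
  exact le_of_tendsto ((hc x).edist (hc y)) (eventually_mem_nhdsWithin.mono h)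

lemma isComplete_rotMetric (n : ℕ) : (rotMetric n).IsComplete := by
  refine @CompleteSpace.mk _ (rotMetric n).metricSpace.toUniformSpace fun {f} hf ↦ ?_
  obtain ⟨hne, h⟩ := (@EMetric.cauchy_iff _ (rotMetric n).metricSpace f).1 hf
  obtain ⟨t, ht, h1⟩ := h 1 one_pos
  obtain ⟨x, hx⟩ := Filter.nonempty_of_mem (hf := ⟨hne⟩) ht
  have hK : IsCompact (Metric.closedBall (0 : EuclideanSpace ℝ (Fin n)) (‖x‖ + 1)) :=
    isCompact_closedBall 0 _
  have hsub : t ⊆ Metric.closedBall (0 : EuclideanSpace ℝ (Fin n)) (‖x‖ + 1) := by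
    intro y hy
    have h2 := (edist_norm_le_edist_rotMetric n y x).trans (h1 y hy x hx).le
    rw [edist_dist, ENNReal.ofReal_le_one, Real.dist_eq, abs_le] at h2
    rw [mem_closedBall_zero_iff]
    linarith
  -- A Euclidean closed ball is compact for `g` too, the two topologies being the same, and it
  -- contains a set of the Cauchy filter.
  obtain ⟨z, -, hz⟩ := @IsCompact.isComplete _ (rotMetric n).metricSpace.toUniformSpace _ hK f hf
    (Filter.le_principal_iff.2 (Filter.mem_of_superset ht hsub))
  exact ⟨z, hz⟩

lemma continuous_rotProfile_norm_sq (n : ℕ) :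
    Continuous fun x : EuclideanSpace ℝ (Fin n) ↦ rotProfile n (‖x‖ ^ 2) := by
  unfold rotProfile
  fun_prop (disch := intro; positivity)

/-- This local bound makes competitors locally Lipschitz in the Euclidean sense, as Rademacher's
theorem requires. -/
lemma exists_rotMetric_ip_le (n : ℕ) (x : EuclideanSpace ℝ (Fin n)) :
    ∃ C : NNReal, ∀ z ∈ Metric.ball x 1, ∀ v, (rotMetric n).ip z v v ≤ (C * ‖v‖) ^ 2 := by
  obtain ⟨M, hM⟩ := (isCompact_closedBall x 1).exists_bound_of_continuousOn
    (continuous_rotProfile_norm_sq n).continuousOn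
  refine ⟨NNReal.sqrt (M + 1).toNNReal, fun z hz v ↦ ?_⟩
  have h := hM z (Metric.ball_subset_closedBall hz)
  have hM0 : 0 ≤ M := (norm_nonneg _).trans h
  rw [rotMetric_ip, mul_pow, ← NNReal.coe_pow, NNReal.sq_sqrt, Real.coe_toNNReal _ (by positivity)]
  refine (rotForm_le n z v).trans ?_
  gcongr
  exact (Real.le_norm_self _).trans h

/-! ### Polar form and volume density -/

lemma isRotationallySymmetric_rotMetric (n : ℕ) : (rotMetric n).IsRotationallySymmetric := by
  have hpos (r : ℝ) : 0 < rotProfile n (r ^ 2) := rotProfile_pos n (sq_nonneg r)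
  have hsq : ContDiff ℝ ∞ fun r : ℝ ↦ r ^ 2 := contDiff_id.pow 2
  have hcd : ContDiff ℝ ∞ fun r : ℝ ↦ r * √(rotProfile n (r ^ 2)) := by
    refine contDiff_id.mul (ContDiff.sqrt ?_ fun r ↦ (hpos r).ne')
    exact ContDiff.div (contDiff_const.add ((hsq.pow _).mul
      ((Real.contDiff_sin.comp (contDiff_const.mul hsq)).pow 2)))
      ((contDiff_const.add hsq).pow 2) fun r ↦ by positivity
  refine ⟨fun r ↦ r * √(rotProfile n (r ^ 2)), hcd.contDiffOn, by simp, ?_, ?_, ?_⟩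
  · have h0 : √(rotProfile n (0 ^ 2)) = 1 := by simp [rotProfile]
    -- The value of this derivative is irrelevant: the product rule multiplies it by `r = 0`.
    have h : HasDerivAt (fun r : ℝ ↦ √(rotProfile n (r ^ 2))) _ 0 :=
      ((ContDiff.sqrt (ContDiff.div (contDiff_const.add ((hsq.pow (2 * n + 6)).mul
      ((Real.contDiff_sin.comp (contDiff_const.mul hsq)).pow 2)))
      ((contDiff_const.add hsq).pow 2) fun r ↦ by positivity)
        fun r ↦ (hpos r).ne').differentiable (by simp) 0).hasDerivAt
    simpa [h0, rotProfile] using ((hasDerivAt_id' (0 : ℝ)).fun_mul h).hasDerivWithinAt (s := Ici 0)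
  · intro r hr
    have := hpos r
    positivity
  · intro r θ hr hθ a b v w hv hw
    have hp := hpos r
    have h1 := rotProfile_eq n (sq_nonneg r)
    rw [rotMetric_ip, rotForm_apply, norm_smul, hθ, mul_one, Real.norm_of_nonneg hr.le, mul_pow,
      Real.sq_sqrt hp.le]
    have hv' : inner ℝ v θ = 0 := by rw [real_inner_comm, hv]
    simp only [inner_add_left, inner_add_right, inner_smul_left, inner_smul_right, hv, hw, hv',
      real_inner_self_eq_norm_sq, hθ, conj_trivial]
    linear_combination (a * b) * h1

/-- A multiple of a rank-one perturbation of the identity, the shape needed for the matrix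
determinant lemma. The perturbation contributes the factor `1 + s D / H = 1 / H` to the determinant,
which turns `H ^ n` into `H ^ (n - 1)`. -/
lemma gram_rotMetric (n : ℕ) (x : EuclideanSpace ℝ (Fin n)) :
    (rotMetric n).gram x = rotProfile n (‖x‖ ^ 2) • (1 + Matrix.replicateCol Unit
      (fun i ↦ rotDefect n (‖x‖ ^ 2) / rotProfile n (‖x‖ ^ 2) * x i) *
        Matrix.replicateRow Unit (fun i ↦ x i)) := by
  have hp := (rotProfile_pos n (sq_nonneg ‖x‖)).ne'
  ext i j
  simp only [SmoothMetric.gram, Matrix.of_apply, rotMetric_ip, rotForm_apply,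
    Matrix.smul_apply, Matrix.add_apply, Matrix.mul_apply, Matrix.replicateCol_apply,
    Matrix.replicateRow_apply, Matrix.one_apply, EuclideanSpace.inner_single_right,
    smul_eq_mul, Finset.univ_unique, Finset.sum_singleton, conj_trivial, one_mul,
    PiLp.single_apply]
  field_simp
  simp only [eq_comm (a := i)]

lemma det_gram_rotMetric {n : ℕ} (hn : 1 ≤ n) (x : EuclideanSpace ℝ (Fin n)) :
    ((rotMetric n).gram x).det = rotProfile n (‖x‖ ^ 2) ^ (n - 1) := by
  have hp := (rotProfile_pos n (sq_nonneg ‖x‖)).ne'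
  have h1 := rotProfile_eq n (sq_nonneg ‖x‖)
  have hx : ∑ i, x i * x i = ‖x‖ ^ 2 := by
    rw [EuclideanSpace.real_norm_sq_eq]
    simp [sq]
  rw [gram_rotMetric, Matrix.det_smul, Matrix.det_one_add_replicateCol_mul_replicateRow,
    Fintype.card_fin, dotProduct]
  have h2 : ∑ i, x i * (rotDefect n (‖x‖ ^ 2) / rotProfile n (‖x‖ ^ 2) * x i) =
      rotDefect n (‖x‖ ^ 2) / rotProfile n (‖x‖ ^ 2) * ‖x‖ ^ 2 := by
    rw [← hx, Finset.mul_sum]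
    exact Finset.sum_congr rfl fun i _ ↦ by ring
  rw [h2]
  obtain ⟨m, rfl⟩ := Nat.exists_eq_add_of_le' hn
  rw [pow_succ, Nat.add_sub_cancel, mul_assoc]
  conv_rhs => rw [← mul_one (_ ^ m)]
  congr 1
  field_simp
  linarith

lemma vol_rotMetric {n : ℕ} (hn : 1 ≤ n) : (rotMetric n).vol = volume.withDensity fun x ↦
    ENNReal.ofReal √(rotProfile n (‖x‖ ^ 2) ^ (n - 1)) := by
  simp only [SmoothMetric.vol, det_gram_rotMetric hn]

/-! ### Radial ramps and the vanishing of `cap_t` -/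

namespace SmoothMetric
variable {n : ℕ}

lemma gradNorm_le {g : SmoothMetric n} {φ : EuclideanSpace ℝ (Fin n) → ℝ}
    {x : EuclideanSpace ℝ (Fin n)} {L : ℝ} (hL : 0 ≤ L)
    (h : ∀ v, fderiv ℝ φ x v ^ 2 ≤ L ^ 2 * g.ip x v v) : g.gradNorm φ x ≤ L := by
  refine Real.sSup_le ?_ hL
  rintro _ ⟨v, hv, rfl⟩
  refine le_of_sq_le_sq ?_ hL
  exact (h v).trans (mul_le_of_le_one_right (sq_nonneg L) hv)

lemma gradNorm_nonneg {g : SmoothMetric n} (φ : EuclideanSpace ℝ (Fin n) → ℝ)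
    (x : EuclideanSpace ℝ (Fin n)) : 0 ≤ g.gradNorm φ x :=
  Real.sSup_nonneg' ⟨0, ⟨0, (map_zero (g.inner x 0)).trans_le zero_le_one, by simp⟩, le_rfl⟩

end SmoothMetric

lemma abs_fderiv_apply_le_rotMetric_gradNorm {n : ℕ} (φ : EuclideanSpace ℝ (Fin n) → ℝ)
    {x v : EuclideanSpace ℝ (Fin n)} (hv : (rotMetric n).ip x v v ≤ 1) :
    |fderiv ℝ φ x v| ≤ (rotMetric n).gradNorm φ x := by
  -- Boundedness has to be checked, as the real supremum of an unbounded set is `0` by convention.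
  have hb : BddAbove {s : ℝ | ∃ v : EuclideanSpace ℝ (Fin n),
      (rotMetric n).ip x v v ≤ 1 ∧ s = fderiv ℝ φ x v} := by
    have hp : 0 < min (rotProfile n (‖x‖ ^ 2)) 1 :=
      lt_min (rotProfile_pos n (sq_nonneg ‖x‖)) one_pos
    refine ⟨‖fderiv ℝ φ x‖ * √(1 / min (rotProfile n (‖x‖ ^ 2)) 1), ?_⟩
    rintro _ ⟨w, hw, rfl⟩
    refine (Real.le_norm_self _).trans (((fderiv ℝ φ x).le_opNorm w).trans ?_)
    gcongr
    refine Real.le_sqrt_of_sq_le ?_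
    rw [le_div_iff₀ hp, mul_comm]
    exact (min_rotProfile_mul_le_rotForm n x w).trans hw
  refine abs_le'.2 ⟨le_csSup hb ⟨v, hv, rfl⟩, le_csSup hb ⟨-v, ?_, by simp⟩⟩
  simpa only [rotMetric_ip, rotForm_apply, inner_neg_left, inner_neg_right, neg_neg,
    neg_mul_neg] using hv

/-- The chain rule is unavailable because `η` may have corners; difference quotients are compared
instead. Where the composition is not differentiable its `fderiv` is `0`. -/
lemma abs_fderiv_lipschitz_comp_le {E : Type*} [NormedAddCommGroup E] [NormedSpace ℝ E]
    {η : ℝ → ℝ} {L : NNReal} (hη : LipschitzWith L η) {ρ : E → ℝ} {ρ' : E →L[ℝ] ℝ} {x : E}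
    (hρ : HasFDerivAt ρ ρ' x) (v : E) : |fderiv ℝ (fun y ↦ η (ρ y)) x v| ≤ L * |ρ' v| := by
  by_cases hd : DifferentiableAt ℝ (fun y ↦ η (ρ y)) x
  · have h1 := (hd.hasFDerivAt.hasLineDerivAt v).tendsto_slope_zero.abs
    have h2 := (hρ.hasLineDerivAt v).tendsto_slope_zero.abs.const_mul (L : ℝ)
    refine le_of_tendsto_of_tendsto' h1 h2 fun t ↦ ?_
    rw [smul_eq_mul, smul_eq_mul, abs_mul, abs_mul, mul_left_comm]
    gcongr
    simpa [Real.dist_eq] using hη.dist_le_mul (ρ (x + t • v)) (ρ x)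
  · rw [fderiv_zero_of_not_differentiableAt hd]
    simp only [zero_apply, abs_zero]
    positivity

/-- The function of `r` that is `t` for `r ≤ a`, `0` for `r ≥ b` and affine in between. -/
def rampDown (t a b r : ℝ) : ℝ := t / (b - a) * max 0 (min (b - a) (b - r))

lemma lipschitzWith_rampDown {t a b : ℝ} (ht : 0 ≤ t) (hab : a < b) :
    LipschitzWith (t / (b - a)).toNNReal (rampDown t a b) := by
  have h : LipschitzWith 1 fun r : ℝ ↦ max 0 (min (b - a) (b - r)) :=
    ((LipschitzWith.of_dist_le_mul fun x y ↦ by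
      rw [NNReal.coe_one, one_mul, dist_sub_left]).const_min (b - a)).const_max 0
  refine LipschitzWith.of_dist_le_mul fun x y ↦ ?_
  have hc : 0 ≤ t / (b - a) := div_nonneg ht (sub_pos.2 hab).le
  have h1 := h.dist_le_mul x y
  rw [NNReal.coe_one, one_mul, Real.dist_eq] at h1
  rw [Real.coe_toNNReal _ hc, rampDown, rampDown, Real.dist_eq, ← mul_sub, abs_mul,
    abs_of_nonneg hc]
  gcongr

lemma rampDown_of_le {t a b r : ℝ} (hab : a < b) (hr : r ≤ a) : rampDown t a b r = t := by
  have := sub_pos.2 hab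
  rw [rampDown, min_eq_left (by linarith), max_eq_right this.le, div_mul_cancel₀ _ this.ne']

lemma rampDown_of_ge {t a b r : ℝ} (hr : b ≤ r) : rampDown t a b r = 0 := by
  rw [rampDown, max_eq_left ((min_le_right _ _).trans (by linarith)), mul_zero]

lemma rampDown_mem_Icc {t a b : ℝ} (ht : 0 ≤ t) (hab : a < b) (r : ℝ) :
    rampDown t a b r ∈ Icc 0 t := by
  have h := sub_pos.2 hab
  refine ⟨mul_nonneg (div_nonneg ht h.le) (le_max_left _ _), ?_⟩
  calc rampDown t a b r ≤ t / (b - a) * (b - a) := by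
        unfold rampDown
        gcongr
        exact max_le h.le (min_le_left _ _)
    _ = t := div_mul_cancel₀ _ h.ne'

lemma rampDown_norm_mem_competitors {n : ℕ} {t a b : ℝ} (ht : 0 ≤ t) (hab : a < b)
    {F : Set (EuclideanSpace ℝ (Fin n))} (hF : F ⊆ Metric.closedBall 0 a) :
    (fun x ↦ rampDown t a b ‖x‖) ∈ (rotMetric n).competitors t F univ := by
  refine ⟨?_, ?_, subset_univ _, fun x ↦ rampDown_mem_Icc ht hab ‖x‖, fun x hx ↦
    rampDown_of_le hab (mem_closedBall_zero_iff.1 (hF hx))⟩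
  · have h : @LipschitzWith _ _ (rotMetric n).metricSpace _ (t / (b - a)).toNNReal
        fun x : EuclideanSpace ℝ (Fin n) ↦ rampDown t a b ‖x‖ := by
      intro x y
      refine (lipschitzWith_rampDown ht hab ‖x‖ ‖y‖).trans ?_
      gcongr
      exact edist_norm_le_edist_rotMetric n x y
    exact @LipschitzWith.locallyLipschitz _ _ (rotMetric n).metricSpace _ _ _ h
  · refine (isCompact_closedBall (0 : EuclideanSpace ℝ (Fin n)) b).of_isClosed_subset
      isClosed_closure (closure_minimal (sdiff_subset.trans ?_) Metric.isClosed_closedBall)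
    refine closure_minimal (fun x hx ↦ ?_) Metric.isClosed_closedBall
    rw [mem_closedBall_zero_iff]
    contrapose! hx
    simpa using rampDown_of_ge hx.le

lemma gradNorm_rampDown_norm_le {n : ℕ} {t a b : ℝ} (ht : 0 ≤ t) (ha : 0 < a) (hab : a < b)
    (x : EuclideanSpace ℝ (Fin n)) :
    (rotMetric n).gradNorm (fun x ↦ rampDown t a b ‖x‖) x ≤
      (Metric.closedBall 0 b \ Metric.ball 0 a).indicator (fun _ ↦ t / (b - a)) x := by
  have hL : 0 ≤ t / (b - a) := div_nonneg ht (sub_pos.2 hab).le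
  have hconst (c : ℝ) {U : Set (EuclideanSpace ℝ (Fin n))} (hU : IsOpen U) (hx : x ∈ U)
      (h : ∀ y ∈ U, rampDown t a b ‖y‖ = c) :
      (rotMetric n).gradNorm (fun x ↦ rampDown t a b ‖x‖) x ≤ 0 := by
    refine SmoothMetric.gradNorm_le le_rfl fun v ↦ ?_
    have h1 : (fun x : EuclideanSpace ℝ (Fin n) ↦ rampDown t a b ‖x‖) =ᶠ[𝓝 x] fun _ ↦ c :=
      Filter.eventually_of_mem (hU.mem_nhds hx) h
    simp [h1.fderiv_eq]
  by_cases hxa : ‖x‖ < a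
  · rw [indicator_of_notMem fun h ↦ h.2 (mem_ball_zero_iff.2 hxa)]
    exact hconst t Metric.isOpen_ball (mem_ball_zero_iff.2 hxa) fun y hy ↦
      rampDown_of_le hab (mem_ball_zero_iff.1 hy).le
  by_cases hxb : b < ‖x‖
  · rw [indicator_of_notMem fun h ↦ hxb.not_ge (mem_closedBall_zero_iff.1 h.1)]
    exact hconst 0 (isOpen_lt continuous_const continuous_norm) hxb fun y hy ↦
      rampDown_of_ge (le_of_lt hy)
  have hx0 : 0 < ‖x‖ := ha.trans_le (not_lt.1 hxa)
  rw [indicator_of_mem (show x ∈ Metric.closedBall 0 b \ Metric.ball 0 a from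
    ⟨mem_closedBall_zero_iff.2 (not_lt.1 hxb), fun h ↦ hxa (mem_ball_zero_iff.1 h)⟩)]
  refine SmoothMetric.gradNorm_le hL fun v ↦ ?_
  have hnorm : HasFDerivAt (fun y : EuclideanSpace ℝ (Fin n) ↦ ‖y‖)
      ((1 / (2 * ‖x‖)) • (2 • innerSL ℝ x)) x := by
    simpa using hasFDerivAt_sqrt_add_norm_sq (ε := 0) x (by positivity)
  have h := abs_fderiv_lipschitz_comp_le (lipschitzWith_rampDown ht hab) hnorm v
  have h2 : ((1 / (2 * ‖x‖)) • (2 • innerSL ℝ x)) v = inner ℝ x v / ‖x‖ := by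
    simp only [smul_apply, innerSL_apply_apply, smul_eq_mul, nsmul_eq_mul]
    push_cast
    field_simp
  rw [h2, Real.coe_toNNReal _ hL] at h
  rw [rotMetric_ip, ← sq_abs]
  refine (pow_le_pow_left₀ (abs_nonneg _) h 2).trans ?_
  rw [mul_pow, sq_abs]
  gcongr
  rw [div_pow, div_le_iff₀ (by positivity), mul_comm]
  exact inner_sq_le_rotForm n x v

lemma volume_annulus_le {n : ℕ} (hn : 1 ≤ n) {a b : ℝ} (ha : 0 ≤ a) (hab : a < b) :
    volume (Metric.closedBall (0 : EuclideanSpace ℝ (Fin n)) b \ Metric.ball 0 a) ≤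
      ENNReal.ofReal ((b - a) * n * b ^ (n - 1)) *
        volume (Metric.ball (0 : EuclideanSpace ℝ (Fin n)) 1) := by
  have : Nonempty (Fin n) := ⟨⟨0, hn⟩⟩
  rw [measure_sdiff (Metric.ball_subset_closedBall.trans (Metric.closedBall_subset_closedBall
    hab.le)) Metric.isOpen_ball.measurableSet.nullMeasurableSet measure_ball_lt_top.ne,
    Measure.addHaar_closedBall _ _ (ha.trans hab.le), Measure.addHaar_ball _ _ ha,
    ← ENNReal.sub_mul fun _ _ ↦ measure_ball_lt_top.ne, finrank_euclideanSpace_fin,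
    ← ENNReal.ofReal_sub _ (by positivity)]
  gcongr
  have h := abs_pow_sub_pow_le b a n
  rw [abs_of_pos (sub_pos.2 hab), abs_of_nonneg ha, abs_of_nonneg (ha.trans hab.le),
    max_eq_left hab.le] at h
  exact (le_abs_self _).trans h

/-- An upper bound for `cap_t`, from a ramp over an annulus on which the metric is thin. -/
lemma capT_rotMetric_le {n : ℕ} (hn : 1 ≤ n) {t a b w : ℝ} (ht : 0 ≤ t) (ha : 0 < a)
    (hab : a < b) (hw : 0 ≤ w) (h : ∀ r ∈ Icc a b, rotProfile n (r ^ 2) ≤ w ^ 2)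
    {F : Set (EuclideanSpace ℝ (Fin n))} (hF : F ⊆ Metric.closedBall 0 a) :
    (rotMetric n).capT t F univ ≤ ENNReal.ofReal (t * n * (w * b) ^ (n - 1)) *
        volume (Metric.ball (0 : EuclideanSpace ℝ (Fin n)) 1) := by
  set A := Metric.closedBall (0 : EuclideanSpace ℝ (Fin n)) b \ Metric.ball 0 a
  have hA : MeasurableSet A := measurableSet_closedBall.diff measurableSet_ball
  have hL : 0 ≤ t / (b - a) := div_nonneg ht (sub_pos.2 hab).le
  have hvol : (rotMetric n).vol A ≤ ENNReal.ofReal (w ^ (n - 1)) * volume A := by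
    rw [vol_rotMetric hn, withDensity_apply _ hA, ← setLIntegral_const]
    refine setLIntegral_mono' hA fun x hx ↦ ENNReal.ofReal_le_ofReal ?_
    refine Real.sqrt_le_iff.2 ⟨by positivity, ?_⟩
    rw [← pow_mul, mul_comm, pow_mul]
    refine pow_le_pow_left₀ (rotProfile_pos n (sq_nonneg _)).le (h _ ⟨?_, ?_⟩) _
    · simpa using hx.2
    · simpa using hx.1
  calc (rotMetric n).capT t F univ
      ≤ ∫⁻ x in univ, ENNReal.ofReal (√(1 + (rotMetric n).gradNorm
          (fun x ↦ rampDown t a b ‖x‖) x ^ 2) - 1) ∂(rotMetric n).vol :=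
        iInf₂_le _ (rampDown_norm_mem_competitors ht hab hF)
    _ ≤ ∫⁻ x, A.indicator (fun _ ↦ ENNReal.ofReal (t / (b - a))) x ∂(rotMetric n).vol := by
        rw [Measure.restrict_univ]
        refine lintegral_mono fun x ↦ ?_
        have h1 := gradNorm_rampDown_norm_le ht ha hab x
        have h0 := SmoothMetric.gradNorm_nonneg (g := rotMetric n)
          (fun x ↦ rampDown t a b ‖x‖) x
        set G := (rotMetric n).gradNorm (fun x ↦ rampDown t a b ‖x‖) x
        -- Linear growth is decisive: the slope `t / (b - a)` will cancel against the factor `b - a`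
        -- in the volume of the annulus, so the width disappears from the bound.
        have h2 : √(1 + G ^ 2) - 1 ≤ G := by
          rw [sub_le_iff_le_add]
          exact Real.sqrt_le_iff.2 ⟨by positivity, by nlinarith⟩
        refine (ENNReal.ofReal_le_ofReal (h2.trans h1)).trans_eq ?_
        by_cases hx : x ∈ A <;> simp [A, hx]
    _ = ENNReal.ofReal (t / (b - a)) * (rotMetric n).vol A := by
        rw [lintegral_indicator_const hA]
    _ ≤ ENNReal.ofReal (t / (b - a)) * (ENNReal.ofReal (w ^ (n - 1)) *
          (ENNReal.ofReal ((b - a) * n * b ^ (n - 1)) *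
            volume (Metric.ball (0 : EuclideanSpace ℝ (Fin n)) 1))) := by
        gcongr
        exact hvol.trans (by gcongr; exact volume_annulus_le hn ha.le hab)
    _ = _ := by
        rw [← mul_assoc, ← mul_assoc, ← ENNReal.ofReal_mul hL, ← ENNReal.ofReal_mul (by positivity)]
        congr 2
        have := (sub_pos.2 hab).ne'
        rw [mul_pow]
        field_simp

lemma capT_rotMetric_eq_zero {n : ℕ} (hn : 2 ≤ n) {t : ℝ} (ht : 0 ≤ t)
    {F : Set (EuclideanSpace ℝ (Fin n))} (hF : IsCompact F) :
    (rotMetric n).capT t F univ = 0 := by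
  obtain ⟨R, hR⟩ := hF.isBounded.subset_closedBall 0
  have hsqrt : Filter.Tendsto (fun m : ℕ ↦ √(m : ℝ)) Filter.atTop Filter.atTop :=
    Real.tendsto_sqrt_atTop.comp tendsto_natCast_atTop_atTop
  have hbound : ∀ᶠ m : ℕ in Filter.atTop, (rotMetric n).capT t F univ ≤
      ENNReal.ofReal (t * n * (3 / √(m : ℝ)) ^ (n - 1)) *
        volume (Metric.ball (0 : EuclideanSpace ℝ (Fin n)) 1) := by
    filter_upwards [hsqrt.eventually_ge_atTop R, Filter.eventually_ge_atTop 1] with m hm hm1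
    have hm0 : (0 : ℝ) < m := by exact_mod_cast hm1
    have ha : 0 < √(m : ℝ) := Real.sqrt_pos.2 hm0
    have hw0 : 0 ≤ √2 / (1 + m) := by positivity
    have hw : (√2 / (1 + m)) ^ 2 = 2 / (1 + (m : ℝ)) ^ 2 := by
      rw [div_pow, Real.sq_sqrt zero_le_two]
    -- At the integer `m` the profile is `1 / (1 + m)²`. The factor `2` leaves room for a strict
    -- inequality, which persists on a short interval to the right of `√m`.
    have hprof : rotProfile n (√(m : ℝ) ^ 2) < (√2 / (1 + m)) ^ 2 := by
      rw [hw, Real.sq_sqrt hm0.le, rotProfile, mul_comm Real.pi, Real.sin_nat_mul_pi]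
      simp only [ne_eq, OfNat.ofNat_ne_zero, not_false_eq_true, zero_pow, mul_zero, add_zero]
      gcongr
      norm_num
    have hcont : Continuous fun r : ℝ ↦ rotProfile n (r ^ 2) := by
      unfold rotProfile
      fun_prop (disch := intro; positivity)
    obtain ⟨δ, hδ, hδ'⟩ := Metric.eventually_nhds_iff.1
      (hcont.continuousAt.eventually_lt continuousAt_const hprof)
    -- The bound `d ≤ √m` gives `b ≤ 2 √m`, whence `w b ≤ 2 √2 √m / (1 + m) ≤ 3 / √m`.
    set d := min (δ / 2) √(m : ℝ)
    have hd : 0 < d := lt_min (half_pos hδ) ha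
    have hd1 : d ≤ δ / 2 := min_le_left _ _
    have hd2 : d ≤ √(m : ℝ) := min_le_right _ _
    refine (capT_rotMetric_le (by lia) ht ha (lt_add_of_pos_right _ hd) hw0
      (fun r hr ↦ (hδ' ?_).le) (hR.trans (Metric.closedBall_subset_closedBall hm))).trans ?_
    · rw [Real.dist_eq, abs_of_nonneg (sub_nonneg.2 hr.1)]
      linarith [hr.2]
    · gcongr
      have h3 : √2 ≤ 3 / 2 := Real.sqrt_le_iff.2 ⟨by norm_num, by norm_num⟩
      rw [le_div_iff₀ ha, div_mul_eq_mul_div, div_mul_eq_mul_div, div_le_iff₀ (by positivity)]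
      have hsq : √(m : ℝ) * √(m : ℝ) = m := Real.mul_self_sqrt hm0.le
      calc √2 * (√(m : ℝ) + d) * √(m : ℝ) ≤ 3 / 2 * (√(m : ℝ) + √(m : ℝ)) * √(m : ℝ) := by
            gcongr
        _ = 3 * m := by linear_combination 3 * hsq
        _ ≤ 3 * (1 + m) := by linarith
  have hlim : Filter.Tendsto (fun m : ℕ ↦ ENNReal.ofReal (t * n * (3 / √(m : ℝ)) ^ (n - 1)) *
      volume (Metric.ball (0 : EuclideanSpace ℝ (Fin n)) 1)) Filter.atTop (𝓝 0) := by
    have h := ((hsqrt.const_div_atTop 3).pow (n - 1)).const_mul (t * n)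
    rw [zero_pow (by lia), mul_zero] at h
    have h' := ENNReal.Tendsto.mul_const (ENNReal.tendsto_ofReal h)
      (Or.inr (measure_ball_lt_top (μ := volume) (x := (0 : EuclideanSpace ℝ (Fin n)))
        (r := 1)).ne)
    rwa [ENNReal.ofReal_zero, zero_mul] at h'
  exact le_antisymm (ge_of_tendsto hlim hbound) zero_le

/-! ### Convergence of the integral of `1 / f^(n-1)` -/

/-- The factor `f(r)^(n-1)` of the volume form. -/
def rotArea (n : ℕ) (r : ℝ) : ℝ := √((r ^ 2 * rotProfile n (r ^ 2)) ^ (n - 1))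

lemma rotArea_pos (n : ℕ) {r : ℝ} (hr : 0 < r) : 0 < rotArea n r := by
  have := rotProfile_pos n (sq_nonneg r)
  unfold rotArea
  positivity

lemma continuous_rotArea (n : ℕ) : Continuous (rotArea n) := by
  unfold rotArea rotProfile
  fun_prop (disch := intro; positivity)

/-- With `y = s ^ (n + 3) |sin πs|` the numerator of the profile is `1 + y²`, and `(1 + y²) ^ (n -
1) ≥ 1 + y² ≥ y`. The exponent is chosen so that a power `s ^ 4` survives division by `(4 s) ^ (n -
1)`; its square root `s ^ 2` makes the later series converge. -/
lemma rotProfile_pow_ge {n : ℕ} (hn : 2 ≤ n) {s : ℝ} (hs : 1 ≤ s) :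
    s ^ 4 * |Real.sin (Real.pi * s)| / 4 ^ (n - 1) ≤ (s * rotProfile n s) ^ (n - 1) := by
  have hs0 : 0 < s := one_pos.trans_le hs
  set σ := |Real.sin (Real.pi * s)| with hσ
  have hz : s ^ (2 * n + 6) * Real.sin (Real.pi * s) ^ 2 = (s ^ (n + 3) * σ) ^ 2 := by
    rw [mul_pow, hσ, sq_abs, ← pow_mul]
    congr 2
    ring
  have h0 : 0 ≤ s ^ (n + 3) * σ := by positivity
  set y := s ^ (n + 3) * σ with hy
  have h1 : (1 + y ^ 2) / (4 * s) ≤ s * rotProfile n s := by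
    rw [rotProfile, hz, mul_div_assoc', div_le_div_iff₀ (by positivity) (by positivity)]
    have : (1 + s) ^ 2 ≤ 4 * s ^ 2 := by nlinarith
    nlinarith [sq_nonneg y]
  calc s ^ 4 * σ / 4 ^ (n - 1) = y / (4 * s) ^ (n - 1) := by
        obtain ⟨m, rfl⟩ := Nat.exists_eq_add_of_le' hn
        rw [hy, mul_pow, show m + 2 + 3 = (m + 2 - 1) + 4 by lia, pow_add]
        field_simp
    _ ≤ (1 + y ^ 2) ^ (n - 1) / (4 * s) ^ (n - 1) := by
        gcongr
        refine le_trans ?_ (le_self_pow₀ (by nlinarith [sq_nonneg y]) (by lia))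
        nlinarith [sq_nonneg (y - 1)]
    _ = ((1 + y ^ 2) / (4 * s)) ^ (n - 1) := (div_pow _ _ _).symm
    _ ≤ _ := by gcongr

lemma inv_sqrt_rotProfile_pow_le {n : ℕ} (hn : 2 ≤ n) {s : ℝ} (hs : 1 ≤ s)
    (hsin : Real.sin (Real.pi * s) ≠ 0) :
    1 / √((s * rotProfile n s) ^ (n - 1)) ≤
      2 ^ (n - 1) / s ^ 2 * (1 / √|Real.sin (Real.pi * s)|) := by
  have hs0 : 0 < s := one_pos.trans_le hs
  have hσ : 0 < |Real.sin (Real.pi * s)| := abs_pos.2 hsin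
  have h : s ^ 2 * √|Real.sin (Real.pi * s)| / 2 ^ (n - 1) ≤
      √((s * rotProfile n s) ^ (n - 1)) := by
    refine Real.le_sqrt_of_sq_le ((le_of_eq ?_).trans (rotProfile_pow_ge hn hs))
    rw [div_pow, mul_pow, Real.sq_sqrt hσ.le, ← pow_mul, ← pow_mul, mul_comm (n - 1), pow_mul 2 2]
    norm_num
  calc 1 / √((s * rotProfile n s) ^ (n - 1))
      ≤ 1 / (s ^ 2 * √|Real.sin (Real.pi * s)| / 2 ^ (n - 1)) := by gcongr
    _ = _ := by field_simp

lemma lintegral_inv_sqrt_abs_sin_lt_top :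
    ∫⁻ u in Ioo (0 : ℝ) 1, ENNReal.ofReal (1 / √|Real.sin (Real.pi * u)|) < ⊤ := by
  have h1 : IntegrableOn (fun u : ℝ ↦ u ^ (-1 / 2 : ℝ)) (Ioo 0 1) :=
    (intervalIntegral.integrableOn_Ioo_rpow_iff one_pos).2 (by norm_num)
  have h2 : IntegrableOn (fun u : ℝ ↦ (1 - u) ^ (-1 / 2 : ℝ)) (Ioo 0 1) := by
    have h := (intervalIntegral.intervalIntegrable_rpow' (a := 0) (b := 1)
      (r := (-1 / 2 : ℝ)) (by norm_num)).comp_sub_left 1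
    rw [sub_zero, sub_self] at h
    exact (h.symm.1).mono_set Ioo_subset_Ioc_self
  refine lt_of_le_of_lt (setLIntegral_mono' measurableSet_Ioo fun u hu ↦ ?_)
    (h1.add h2).lintegral_lt_top
  refine ENNReal.ofReal_le_ofReal ?_
  have hp := Real.pi_pos
  have hu1 : 0 < 1 - u := sub_pos.2 hu.2
  -- Jordan's inequality `sin x ≥ 2 x / π` on `[0, π / 2]`; the other half of the interval follows
  -- by the symmetry `u ↦ 1 - u`.
  have key {v : ℝ} (hv : 0 < v) (hv' : v ≤ 1 / 2) :
      1 / √|Real.sin (Real.pi * v)| ≤ v ^ (-1 / 2 : ℝ) := by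
    have hsin : v ≤ |Real.sin (Real.pi * v)| := by
      have := Real.mul_le_sin (x := Real.pi * v) (by positivity) (by nlinarith)
      rw [← mul_assoc, div_mul_cancel₀ _ hp.ne'] at this
      exact (by linarith : v ≤ Real.sin (Real.pi * v)).trans (le_abs_self _)
    rw [neg_div, Real.rpow_neg hv.le, ← Real.sqrt_eq_rpow, ← one_div]
    gcongr
  rcases le_total u (1 / 2) with h | h
  · exact (key hu.1 h).trans (le_add_of_nonneg_right (by positivity))
  · have h3 := key hu1 (by linarith)
    rw [mul_sub, mul_one, Real.sin_pi_sub] at h3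
    exact h3.trans (le_add_of_nonneg_left (Real.rpow_nonneg hu.1.le _))

lemma lintegral_inv_sqrt_abs_sin_add_nat (m : ℕ) :
    ∫⁻ u in Ioo (m : ℝ) (m + 1), ENNReal.ofReal (1 / √|Real.sin (Real.pi * u)|) =
      ∫⁻ u in Ioo (0 : ℝ) 1, ENNReal.ofReal (1 / √|Real.sin (Real.pi * u)|) := by
  rw [← (measurePreserving_add_right volume (m : ℝ)).setLIntegral_comp_preimage_emb
    (measurableEmbedding_addRight (m : ℝ))]
  have h : (fun x : ℝ ↦ x + m) ⁻¹' Ioo (m : ℝ) (m + 1) = Ioo 0 1 := by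
    rw [preimage_add_const_Ioo]
    simp
  rw [h]
  refine lintegral_congr fun u ↦ ?_
  rw [mul_add, mul_comm Real.pi (m : ℝ), Real.sin_add_nat_mul_pi, abs_mul, abs_pow, abs_neg,
    abs_one, one_pow, one_mul]

lemma lintegral_inv_sqrt_rotProfile_pow_lt_top {n : ℕ} (hn : 2 ≤ n) :
    ∫⁻ s in Ioi (1 : ℝ), ENNReal.ofReal (1 / √((s * rotProfile n s) ^ (n - 1))) < ⊤ := by
  set I := ∫⁻ u in Ioo (0 : ℝ) 1, ENNReal.ofReal (1 / √|Real.sin (Real.pi * u)|) with hI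
  have hcover : Ioi (1 : ℝ) ⊆ ⋃ m : ℕ, Ico ((m + 1 : ℕ) : ℝ) ((m + 1 : ℕ) + 1) := by
    intro x hx
    have hx1 : 1 ≤ ⌊x⌋₊ := Nat.le_floor (by simpa using hx.le)
    refine mem_iUnion.2 ⟨⌊x⌋₊ - 1, ?_⟩
    rw [Nat.sub_add_cancel hx1]
    exact ⟨Nat.floor_le (zero_le_one.trans hx.le), Nat.lt_floor_add_one x⟩
  have hpiece (m : ℕ) : ∫⁻ s in Ico ((m + 1 : ℕ) : ℝ) ((m + 1 : ℕ) + 1),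
      ENNReal.ofReal (1 / √((s * rotProfile n s) ^ (n - 1))) ≤
      ENNReal.ofReal (2 ^ (n - 1) * (1 / ((m + 1 : ℕ) : ℝ) ^ 2)) * I := by
    -- The left endpoint is dropped because the pointwise bound needs `sin πs ≠ 0`.
    rw [← restrict_Ioo_eq_restrict_Ico, hI, ← lintegral_inv_sqrt_abs_sin_add_nat (m + 1),
      ← lintegral_const_mul' _ _ ENNReal.ofReal_ne_top]
    refine setLIntegral_mono' measurableSet_Ioo fun s hs ↦ ?_
    have hm : (1 : ℝ) ≤ ((m + 1 : ℕ) : ℝ) := by exact_mod_cast Nat.le_add_left 1 m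
    have hsin : Real.sin (Real.pi * s) ≠ 0 := by
      intro h0
      obtain ⟨k, hk⟩ := Real.sin_eq_zero_iff.1 h0
      rw [mul_comm] at hk
      have hks : (k : ℝ) = s := mul_left_cancel₀ Real.pi_ne_zero hk
      rw [← hks] at hs
      have h1 : ((m + 1 : ℕ) : ℤ) < k := by exact_mod_cast hs.1
      have h2 : k < ((m + 1 : ℕ) : ℤ) + 1 := by exact_mod_cast hs.2
      lia
    rw [← ENNReal.ofReal_mul (by positivity)]
    refine ENNReal.ofReal_le_ofReal
      ((inv_sqrt_rotProfile_pow_le hn (hm.trans hs.1.le) hsin).trans ?_)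
    rw [mul_one_div ((2 : ℝ) ^ (n - 1))]
    have h1 : ((m + 1 : ℕ) : ℝ) ^ 2 ≤ s ^ 2 := pow_le_pow_left₀ (by positivity) hs.1.le 2
    gcongr
  refine (lintegral_mono_set hcover).trans_lt ((lintegral_iUnion_le _ _).trans_lt
    ((ENNReal.tsum_le_tsum hpiece).trans_lt ?_))
  rw [ENNReal.tsum_mul_right]
  refine ENNReal.mul_lt_top ?_ lintegral_inv_sqrt_abs_sin_lt_top
  have hsum : Summable fun m : ℕ ↦ 2 ^ (n - 1) * (1 / ((m + 1 : ℕ) : ℝ) ^ 2) :=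
    ((summable_nat_add_iff 1).2 (Real.summable_one_div_nat_pow.2 one_lt_two)).mul_left _
  exact hsum.tsum_ofReal_lt_top

/-- The integral of `1 / f(r)^(n-1)` converges at infinity. -/
lemma lintegral_inv_rotArea_lt_top {n : ℕ} (hn : 2 ≤ n) {ρ : ℝ} (hρ : 0 < ρ) :
    ∫⁻ r in Ioi ρ, ENNReal.ofReal (1 / rotArea n r) < ⊤ := by
  have h1 : ∫⁻ r in Ioi (1 : ℝ), ENNReal.ofReal (1 / rotArea n r) < ⊤ := by
    refine lt_of_le_of_lt ?_ (lintegral_inv_sqrt_rotProfile_pow_lt_top hn)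
    have himg : (fun r : ℝ ↦ r ^ 2) '' Ioi 1 ⊆ Ioi 1 := by
      rintro _ ⟨r, hr, rfl⟩
      exact one_lt_pow₀ (mem_Ioi.1 hr) two_ne_zero
    refine le_trans ?_ (lintegral_mono_set himg)
    -- Substitution `s = r²`; the Jacobian `2 r` is at least `1` here and can be discarded.
    rw [lintegral_image_eq_lintegral_abs_deriv_mul measurableSet_Ioi
      (fun r _ ↦ (hasDerivAt_pow 2 r).hasDerivWithinAt)
      fun a ha b hb h ↦ (pow_left_inj₀ (zero_le_one.trans (le_of_lt ha))
        (zero_le_one.trans (le_of_lt hb)) two_ne_zero).1 h]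
    refine setLIntegral_mono' measurableSet_Ioi fun r hr ↦ ?_
    refine le_mul_of_one_le_left' (ENNReal.one_le_ofReal.2 ?_)
    have hr' : 1 < r := hr
    simp only [Nat.cast_ofNat, Nat.add_one_sub_one, pow_one]
    rw [abs_of_nonneg] <;> linarith
  have h2 : ∫⁻ r in Icc ρ 1, ENNReal.ofReal (1 / rotArea n r) < ⊤ := by
    refine Integrable.lintegral_lt_top (ContinuousOn.integrableOn_compact isCompact_Icc ?_)
    exact continuousOn_const.div (continuous_rotArea n).continuousOn
      fun r hr ↦ (rotArea_pos n (hρ.trans_le hr.1)).ne'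
  have hsub : Ioi ρ ⊆ Icc ρ 1 ∪ Ioi 1 := fun r hr ↦
    (le_or_gt r 1).imp (fun h ↦ ⟨le_of_lt hr, h⟩) id
  exact ((lintegral_mono_set hsub).trans (lintegral_union_le _ _ _)).trans_lt
    (ENNReal.add_lt_top.2 ⟨h2, h1⟩)

/-! ### Integration in polar coordinates -/

section Polar

variable {E : Type*} [NormedAddCommGroup E] [NormedSpace ℝ E] [MeasurableSpace E] [BorelSpace E]
  [FiniteDimensional ℝ E]

omit [FiniteDimensional ℝ E] in
lemma measurable_polar {G : E → ℝ≥0∞} (hG : Measurable G) (k : ℕ) :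
    Measurable fun p : Metric.sphere (0 : E) 1 × ℝ ↦
      ENNReal.ofReal (p.2 ^ k) * G (p.2 • (p.1 : E)) := by
  have h : Measurable fun p : Metric.sphere (0 : E) 1 × ℝ ↦ p.2 • (p.1 : E) :=
    (continuous_snd.smul (continuous_subtype_val.comp continuous_fst)).measurable
  exact ((measurable_snd.pow_const k).ennreal_ofReal).mul (hG.comp h)

/-- Integration in polar coordinates. -/
lemma lintegral_eq_lintegral_sphere_Ioi (μ : Measure E) [μ.IsAddHaarMeasure] [Nontrivial E]
    {G : E → ℝ≥0∞} (hG : Measurable G) :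
    ∫⁻ x, G x ∂μ = ∫⁻ θ, ∫⁻ r in Ioi (0 : ℝ),
      ENNReal.ofReal (r ^ (Module.finrank ℝ E - 1)) * G (r • (θ : E)) ∂volume ∂μ.toSphere := by
  have hsymm (x : ({0}ᶜ : Set E)) :
      G ((homeomorphUnitSphereProd E).symm (homeomorphUnitSphereProd E x)) = G x := by simp
  have hmeas : Measurable fun p : Metric.sphere (0 : E) 1 × Ioi (0 : ℝ) ↦
      G ((homeomorphUnitSphereProd E).symm p) :=
    hG.comp (measurable_subtype_coe.comp (homeomorphUnitSphereProd E).symm.measurable)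
  have h0 : ∫⁻ x, G x ∂μ = ∫⁻ x in {0}ᶜ, G x ∂μ := by rw [restrict_compl_singleton]
  rw [h0, ← lintegral_subtype_comap (measurableSet_singleton _).compl]
  rw [← lintegral_congr hsymm, μ.measurePreserving_homeomorphUnitSphereProd.lintegral_comp_emb
    (Homeomorph.measurableEmbedding _) fun p ↦ G ((homeomorphUnitSphereProd E).symm p),
    lintegral_prod _ hmeas.aemeasurable]
  refine lintegral_congr fun θ ↦ ?_
  rw [Measure.volumeIoiPow, lintegral_withDensity_eq_lintegral_mul _
    (measurable_subtype_coe.pow_const _).ennreal_ofReal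
    (g := fun r ↦ G ((homeomorphUnitSphereProd E).symm (θ, r))) (hmeas.comp measurable_prodMk_left),
    ← lintegral_subtype_comap measurableSet_Ioi]
  rfl

omit [FiniteDimensional ℝ E] in
lemma measurable_lintegral_polar {G : E → ℝ≥0∞} (hG : Measurable G) (k : ℕ) :
    Measurable fun θ : Metric.sphere (0 : E) 1 ↦
      ∫⁻ r in Ioi (0 : ℝ), ENNReal.ofReal (r ^ k) * G (r • (θ : E)) :=
  (measurable_polar hG k).lintegral_prod_right'

/-- A property that holds almost everywhere holds almost everywhere on almost every ray. -/
lemma ae_sphere_ae_Ioi (μ : Measure E) [μ.IsAddHaarMeasure] [Nontrivial E]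
    {p : E → Prop} (hp : MeasurableSet {x | p x}) (h : ∀ᵐ x ∂μ, p x) :
    ∀ᵐ θ : Metric.sphere (0 : E) 1 ∂μ.toSphere, ∀ᵐ r : ℝ, 0 < r → p (r • (θ : E)) := by
  set G : E → ℝ≥0∞ := {x | p x}ᶜ.indicator 1 with hGdef
  have hG : Measurable G := measurable_one.indicator hp.compl
  have h0 : ∫⁻ x, G x ∂μ = 0 := by
    rw [hGdef, lintegral_indicator_one hp.compl]
    exact h
  rw [lintegral_eq_lintegral_sphere_Ioi μ hG,
    lintegral_eq_zero_iff (measurable_lintegral_polar hG _)] at h0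
  filter_upwards [h0] with θ hθ
  have hm := (measurable_polar hG (Module.finrank ℝ E - 1)).comp
    (measurable_prodMk_left (x := θ))
  have h1 := (lintegral_eq_zero_iff hm).1 hθ
  rw [Filter.EventuallyEq, ae_restrict_iff' measurableSet_Ioi] at h1
  filter_upwards [h1] with r hr hr0
  by_contra hnot
  have h2 := hr hr0
  simp only [Function.comp_apply, Pi.zero_apply, mul_eq_zero, ENNReal.ofReal_eq_zero] at h2
  rcases h2 with h2 | h2
  · exact (pow_pos hr0 _).not_ge h2
  · rw [hGdef, indicator_of_mem (show r • (θ : E) ∈ {x | p x}ᶜ from hnot)] at h2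
    exact one_ne_zero h2

end Polar

/-! ### Rademacher's theorem and the energy along a ray -/

lemma LocallyLipschitz.lipschitzOnWith_of_isCompact {X : Type*} [PseudoMetricSpace X]
    {φ : X → ℝ} (hφ : LocallyLipschitz φ) {K : Set X} (hK : IsCompact K) :
    ∃ C, LipschitzOnWith C φ K :=
  hφ.locallyLipschitzOn.exists_lipschitzOnWith_of_compact hK

/-- Rademacher's theorem for locally Lipschitz functions. -/
lemma LocallyLipschitz.ae_differentiableAt {E : Type*} [NormedAddCommGroup E] [NormedSpace ℝ E]
    [FiniteDimensional ℝ E] [MeasurableSpace E] [BorelSpace E] {μ : Measure E}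
    [μ.IsAddHaarMeasure] {φ : E → ℝ} (hφ : LocallyLipschitz φ) :
    ∀ᵐ x ∂μ, DifferentiableAt ℝ φ x := by
  have h (k : ℕ) : ∀ᵐ x ∂μ, x ∈ Metric.closedBall (0 : E) k →
      DifferentiableWithinAt ℝ φ (Metric.closedBall 0 k) x := by
    obtain ⟨C, hC⟩ := hφ.lipschitzOnWith_of_isCompact (isCompact_closedBall (0 : E) k)
    exact hC.ae_differentiableWithinAt_of_mem
  filter_upwards [ae_all_iff.2 h] with x hx
  obtain ⟨k, hk⟩ := exists_nat_gt ‖x‖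
  have hk' : x ∈ Metric.ball (0 : E) k := mem_ball_zero_iff.2 hk
  exact (hx k (Metric.ball_subset_closedBall hk')).differentiableAt
    (Filter.mem_of_superset (Metric.isOpen_ball.mem_nhds hk') Metric.ball_subset_closedBall)

/-- Cauchy-Schwarz with a weight, for a function with integral at least one. -/
lemma inv_lintegral_inv_le_lintegral_mul_sq {s : Set ℝ} (hs : MeasurableSet s) {a w : ℝ → ℝ}
    (ha : Measurable a) (hw : Measurable w) (hw0 : ∀ r ∈ s, 0 < w r)
    (h : 1 ≤ ∫⁻ r in s, ‖a r‖ₑ) :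
    (∫⁻ r in s, ENNReal.ofReal (1 / w r))⁻¹ ≤ ∫⁻ r in s, ENNReal.ofReal (w r * a r ^ 2) := by
  set J := ∫⁻ r in s, ENNReal.ofReal (1 / w r)
  set X := ∫⁻ r in s, ENNReal.ofReal (w r * a r ^ 2)
  have hcs : ∫⁻ r in s, ‖a r‖ₑ ≤ (X * J) ^ (1 / 2 : ℝ) := by
    have h1 := ENNReal.lintegral_mul_le_Lp_mul_Lq (volume.restrict s) Real.HolderConjugate.two_two
      (f := fun r ↦ ENNReal.ofReal (√(w r) * |a r|)) (g := fun r ↦ ENNReal.ofReal (1 / √(w r)))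
      (by fun_prop) (by fun_prop)
    have e1 : ∫⁻ r in s, ‖a r‖ₑ = ∫⁻ r in s, ((fun r ↦ ENNReal.ofReal (√(w r) * |a r|)) *
        fun r ↦ ENNReal.ofReal (1 / √(w r))) r := by
      refine setLIntegral_congr_fun hs fun r hr ↦ ?_
      have := Real.sqrt_pos.2 (hw0 r hr)
      rw [Pi.mul_apply, ← ENNReal.ofReal_mul (by positivity), ← ofReal_norm, Real.norm_eq_abs]
      congr 1
      field_simp
    have e2 : ∫⁻ r in s, ENNReal.ofReal (√(w r) * |a r|) ^ (2 : ℝ) = X := by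
      refine setLIntegral_congr_fun hs fun r hr ↦ ?_
      rw [ENNReal.ofReal_rpow_of_nonneg (by positivity) zero_le_two, Real.rpow_two, mul_pow,
        Real.sq_sqrt (hw0 r hr).le, sq_abs]
    have e3 : ∫⁻ r in s, ENNReal.ofReal (1 / √(w r)) ^ (2 : ℝ) = J := by
      refine setLIntegral_congr_fun hs fun r hr ↦ ?_
      rw [ENNReal.ofReal_rpow_of_nonneg (by positivity) zero_le_two, Real.rpow_two, div_pow,
        Real.sq_sqrt (hw0 r hr).le, one_pow]
    rw [e1, ENNReal.mul_rpow_of_nonneg _ _ (by norm_num)]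
    rw [e2, e3] at h1
    exact h1
  have hXJ : 1 ≤ X * J := by
    by_contra! hlt
    exact (h.trans hcs).not_gt (ENNReal.rpow_lt_one hlt (by norm_num))
  rw [mul_comm] at hXJ
  -- The side conditions exclude products `0 * ⊤`, which would contradict `1 ≤ J * X`.
  refine (ENNReal.inv_le_iff_le_mul ?_ ?_).2 hXJ
  · rintro - hJ
    simp [hJ] at hXJ
  · rintro - hX
    simp [hX] at hXJ

/-- The weighted energy of a function along a ray from a point where it is `1`. -/
lemma inv_lintegral_inv_le_lintegral_ray {E : Type*} [NormedAddCommGroup E] [NormedSpace ℝ E]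
    {φ : E → ℝ} (hφ : LocallyLipschitz φ) {R : ℝ} (hR : ∀ x, R ≤ ‖x‖ → φ x = 0)
    {w : ℝ → ℝ} (hw : Measurable w) {ρ : ℝ} (hρ : 0 < ρ) (hw0 : ∀ r ∈ Ioi ρ, 0 < w r)
    {θ : E} (hθ : ‖θ‖ = 1) (hd : ∀ᵐ r : ℝ, 0 < r → DifferentiableAt ℝ φ (r • θ))
    {r₀ : ℝ} (hr₀ : ρ ≤ r₀) (h1 : φ (r₀ • θ) = 1) :
    (∫⁻ r in Ioi ρ, ENNReal.ofReal (1 / w r))⁻¹ ≤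
      ∫⁻ r in Ioi ρ, ENNReal.ofReal (w r * (fderiv ℝ φ (r • θ) θ) ^ 2) := by
  set h : ℝ → ℝ := fun r ↦ φ (r • θ) with hh
  have hderiv : ∀ᵐ r : ℝ, 0 < r → deriv h r = fderiv ℝ φ (r • θ) θ := by
    filter_upwards [hd] with r hr hr0
    have h2 : HasDerivAt (fun r : ℝ ↦ r • θ) θ r := by
      simpa using (hasDerivAt_id r).smul_const θ
    exact ((hr hr0).hasFDerivAt.comp_hasDerivAt r h2).deriv
  have hlip : LocallyLipschitz h := by
    have : LipschitzWith 1 fun r : ℝ ↦ r • θ := LipschitzWith.of_dist_le_mul fun x y ↦ by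
      rw [dist_eq_norm, ← sub_smul, norm_smul, hθ, mul_one, NNReal.coe_one, one_mul, dist_eq_norm]
    exact hφ.comp this.locallyLipschitz
  set b := max r₀ R
  have hb : h b = 0 := hR _ (by
    rw [norm_smul, hθ, mul_one]
    exact (le_max_right _ _).trans (le_abs_self _))
  have hint : 1 ≤ ∫⁻ r in Ioi ρ, ‖deriv h r‖ₑ := by
    -- A Lipschitz function is absolutely continuous, so its almost everywhere derivative integrates
    -- to the drop from `1` at `r₀` to `0` at `b`.
    obtain ⟨C, hC⟩ := hlip.lipschitzOnWith_of_isCompact (isCompact_uIcc (a := r₀) (b := b))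
    have hftc := hC.absolutelyContinuousOnInterval.integral_deriv_eq_sub
    rw [hb, show h r₀ = 1 from h1, intervalIntegral.integral_of_le (le_max_left _ _)] at hftc
    calc (1 : ℝ≥0∞) = ‖∫ r in Ioc r₀ b, deriv h r‖ₑ := by rw [hftc]; simp
      _ ≤ ∫⁻ r in Ioc r₀ b, ‖deriv h r‖ₑ := enorm_integral_le_lintegral_enorm _
      _ ≤ _ := lintegral_mono_set fun r hr ↦ hr₀.trans_lt hr.1
  refine (inv_lintegral_inv_le_lintegral_mul_sq measurableSet_Ioi (measurable_deriv h) hw hw0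
    hint).trans_eq (lintegral_congr_ae ?_)
  rw [Filter.EventuallyEq, ae_restrict_iff' measurableSet_Ioi]
  filter_upwards [hderiv] with r hr hr0
  rw [hr (hρ.trans hr0)]

/-! ### Positivity of the classical capacity -/

/-- The square of the radial derivative of `φ` at `x`. -/
def radialDerivSq {n : ℕ} (φ : EuclideanSpace ℝ (Fin n) → ℝ) (x : EuclideanSpace ℝ (Fin n)) : ℝ :=
  (fderiv ℝ φ x x / ‖x‖) ^ 2

lemma measurable_radialDerivSq {n : ℕ} (φ : EuclideanSpace ℝ (Fin n) → ℝ) :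
    Measurable (radialDerivSq φ) := by
  have h : Measurable fun x : EuclideanSpace ℝ (Fin n) ↦ fderiv ℝ φ x x := by
    have h1 (x : EuclideanSpace ℝ (Fin n)) :
        fderiv ℝ φ x x = ∑ i, x i * fderiv ℝ φ x (EuclideanSpace.single i 1) := by
      have h2 := congrArg (fderiv ℝ φ x) ((EuclideanSpace.basisFun (Fin n) ℝ).sum_repr x)
      simpa [map_sum] using h2.symm
    simp_rw [h1]
    refine Finset.measurable_sum _ fun i _ ↦ Measurable.mul ?_ (measurable_fderiv_apply_const ℝ φ _)
    exact (EuclideanSpace.proj (𝕜 := ℝ) i).measurable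
  exact (h.div measurable_norm).pow_const 2

/-- The vector `x / ‖x‖` has `g`-length one, so it is admissible in the supremum that defines
`gradNorm`. At the origin the radial derivative is `0 / 0 = 0`. -/
lemma radialDerivSq_le_gradNorm_sq {n : ℕ} (φ : EuclideanSpace ℝ (Fin n) → ℝ)
    (x : EuclideanSpace ℝ (Fin n)) :
    radialDerivSq φ x ≤ (rotMetric n).gradNorm φ x ^ 2 := by
  rcases eq_or_ne x 0 with rfl | hx
  · simp [radialDerivSq, sq_nonneg]
  have hx0 : ‖x‖ ≠ 0 := norm_ne_zero_iff.2 hx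
  have hip : (rotMetric n).ip x (‖x‖⁻¹ • x) (‖x‖⁻¹ • x) ≤ 1 := by
    rw [rotMetric_ip, rotForm_apply]
    simp only [inner_smul_left, inner_smul_right, conj_trivial, real_inner_self_eq_norm_sq]
    rw [rotProfile_eq n (sq_nonneg ‖x‖)]
    field_simp
    linarith
  have h := abs_fderiv_apply_le_rotMetric_gradNorm φ hip
  rw [map_smul, smul_eq_mul, inv_mul_eq_div] at h
  rw [radialDerivSq, ← sq_abs]
  exact pow_le_pow_left₀ (abs_nonneg _) h 2

lemma radialDerivSq_smul {n : ℕ} (φ : EuclideanSpace ℝ (Fin n) → ℝ) {r : ℝ} (hr : 0 < r)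
    {θ : EuclideanSpace ℝ (Fin n)} (hθ : ‖θ‖ = 1) :
    radialDerivSq φ (r • θ) = fderiv ℝ φ (r • θ) θ ^ 2 := by
  rw [radialDerivSq, map_smul, norm_smul, hθ, mul_one, Real.norm_of_nonneg hr.le, smul_eq_mul,
    mul_div_cancel_left₀ _ hr.ne']

lemma measurable_rotDensity (n : ℕ) : Measurable fun x : EuclideanSpace ℝ (Fin n) ↦
    ENNReal.ofReal √(rotProfile n (‖x‖ ^ 2) ^ (n - 1)) :=
  ((continuous_rotProfile_norm_sq n).pow _).sqrt.measurable.ennreal_ofReal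

lemma lintegral_polar_rotArea_le {n : ℕ} (hn : 2 ≤ n) (φ : EuclideanSpace ℝ (Fin n) → ℝ) :
    ∫⁻ θ : Metric.sphere (0 : EuclideanSpace ℝ (Fin n)) 1, ∫⁻ r in Ioi (0 : ℝ),
      ENNReal.ofReal (rotArea n r * fderiv ℝ φ (r • (θ : EuclideanSpace ℝ (Fin n))) θ ^ 2)
        ∂volume ∂(volume : Measure (EuclideanSpace ℝ (Fin n))).toSphere ≤
      ∫⁻ x, ENNReal.ofReal ((rotMetric n).gradNorm φ x ^ 2) ∂(rotMetric n).vol := by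
  have : Nonempty (Fin n) := ⟨⟨0, by lia⟩⟩
  have hρ := measurable_rotDensity n
  have hD := (measurable_radialDerivSq φ).ennreal_ofReal
  calc _ = ∫⁻ x, ENNReal.ofReal (radialDerivSq φ x) ∂(rotMetric n).vol := by
        rw [vol_rotMetric (by lia), lintegral_withDensity_eq_lintegral_mul _ hρ hD,
          lintegral_eq_lintegral_sphere_Ioi volume (hρ.mul hD)]
        refine lintegral_congr fun θ ↦ setLIntegral_congr_fun measurableSet_Ioi fun r hr ↦ ?_
        have hθ : ‖(θ : EuclideanSpace ℝ (Fin n))‖ = 1 := norm_eq_of_mem_sphere θ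
        have hr0 : 0 < r := hr
        rw [Pi.mul_apply, radialDerivSq_smul φ hr0 hθ, norm_smul, hθ, mul_one,
          Real.norm_of_nonneg hr0.le, finrank_euclideanSpace_fin, ← mul_assoc,
          ← ENNReal.ofReal_mul (by positivity), ← ENNReal.ofReal_mul (by positivity), rotArea,
          mul_pow, Real.sqrt_mul (by positivity), ← pow_mul, mul_comm 2, pow_mul,
          Real.sqrt_sq (by positivity)]
    _ ≤ _ := lintegral_mono fun x ↦ ENNReal.ofReal_le_ofReal (radialDerivSq_le_gradNorm_sq φ x)

/-- The directions in which the ray from the origin meets `F` at distance at least `ρ`. -/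
def shadow {E : Type*} [NormedAddCommGroup E] [NormedSpace ℝ E] (F : Set E) (ρ : ℝ) :
    Set (Metric.sphere (0 : E) 1) :=
  {θ | ∃ r, ρ ≤ r ∧ r • (θ : E) ∈ F}

/-- As `F` is bounded, only `r ∈ [ρ, R]` matter, and the shadow is the projection of a compact
subset of sphere times interval. -/
lemma measurableSet_shadow {n : ℕ} {F : Set (EuclideanSpace ℝ (Fin n))} (hF : IsCompact F)
    (ρ : ℝ) : MeasurableSet (shadow F ρ) := by
  obtain ⟨R, hR⟩ := hF.isBounded.subset_closedBall 0
  have hK : IsCompact ((univ ×ˢ Icc ρ R : Set (Metric.sphere (0 : EuclideanSpace ℝ (Fin n)) 1 × ℝ))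
      ∩ (fun p ↦ p.2 • (p.1 : EuclideanSpace ℝ (Fin n))) ⁻¹' F) :=
    (isCompact_univ.prod isCompact_Icc).inter_right (hF.isClosed.preimage
      (continuous_snd.smul (continuous_subtype_val.comp continuous_fst)))
  convert (hK.image continuous_fst).isClosed.measurableSet using 1
  ext θ
  constructor
  · rintro ⟨r, hr, hrF⟩
    have h := mem_closedBall_zero_iff.1 (hR hrF)
    rw [norm_smul, norm_eq_of_mem_sphere θ, mul_one] at h
    exact ⟨(θ, r), ⟨⟨mem_univ _, hr, (Real.le_norm_self r).trans h⟩, hrF⟩, rfl⟩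
  · rintro ⟨⟨_, r⟩, ⟨⟨-, hr, -⟩, hrF⟩, rfl⟩
    exact ⟨r, hr, hrF⟩

lemma volume_diff_ball_eq_zero {n : ℕ} (hn : 1 ≤ n) {F : Set (EuclideanSpace ℝ (Fin n))}
    (hF : MeasurableSet F) {ρ : ℝ}
    (h : (volume : Measure (EuclideanSpace ℝ (Fin n))).toSphere (shadow F ρ) = 0) :
    volume (F \ Metric.ball 0 ρ) = 0 := by
  have : Nonempty (Fin n) := ⟨⟨0, hn⟩⟩
  have hm := hF.diff (measurableSet_ball (x := (0 : EuclideanSpace ℝ (Fin n))) (ε := ρ))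
  rw [← lintegral_indicator_one hm,
    lintegral_eq_lintegral_sphere_Ioi volume (measurable_one.indicator hm)]
  rw [lintegral_eq_zero_iff (measurable_lintegral_polar (measurable_one.indicator hm) _)]
  filter_upwards [measure_eq_zero_iff_ae_notMem.1 h] with θ hθ
  refine setLIntegral_eq_zero measurableSet_Ioi fun r hr ↦ ?_
  have hr0 : 0 < r := hr
  rw [indicator_of_notMem, mul_zero]
  · rfl
  · rintro ⟨hrF, hrρ⟩
    rw [mem_ball_zero_iff, norm_smul, norm_eq_of_mem_sphere θ, mul_one,
      Real.norm_of_nonneg hr0.le, not_lt] at hrρ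
    exact hθ ⟨r, hrρ, hrF⟩

/-- A lower bound for the classical capacity, from the energy on the rays that meet `F`. -/
lemma le_cap_rotMetric {n : ℕ} (hn : 2 ≤ n) {F : Set (EuclideanSpace ℝ (Fin n))}
    (hF : IsCompact F) {ρ : ℝ} (hρ : 0 < ρ) :
    (∫⁻ r in Ioi ρ, ENNReal.ofReal (1 / rotArea n r))⁻¹ *
      (volume : Measure (EuclideanSpace ℝ (Fin n))).toSphere (shadow F ρ) ≤
        (rotMetric n).cap F univ := by
  have : Nonempty (Fin n) := ⟨⟨0, by lia⟩⟩
  refine le_iInf₂ fun φ hφ ↦ ?_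
  obtain ⟨hlip, hcomp, -, -, h1⟩ := hφ
  have hloc : LocallyLipschitz φ := hlip.locallyLipschitz (exists_rotMetric_ip_le n)
  -- Only the support outside `F` is assumed relatively compact; boundedness of `F` gives the rest.
  obtain ⟨R, hR⟩ := (hcomp.isBounded.union hF.isBounded).subset_ball 0
  have hzero (x : EuclideanSpace ℝ (Fin n)) (hx : R ≤ ‖x‖) : φ x = 0 := by
    by_contra hne
    refine (mem_ball_zero_iff.1 (hR ?_)).not_ge hx
    by_cases hxF : x ∈ F
    · exact Or.inr hxF
    · exact Or.inl (subset_closure ⟨subset_tsupport φ hne, hxF⟩)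
  have hae := ae_sphere_ae_Ioi volume (measurableSet_of_differentiableAt ℝ φ)
    (hloc.ae_differentiableAt (μ := volume))
  rw [Measure.restrict_univ, ← setLIntegral_const]
  refine le_trans ?_ (lintegral_polar_rotArea_le hn φ)
  refine le_trans (setLIntegral_mono_ae' (measurableSet_shadow hF ρ) ?_)
    (setLIntegral_le_lintegral (shadow F ρ) _)
  filter_upwards [hae] with θ hθ ⟨r₀, hr₀, hr₀F⟩
  exact (inv_lintegral_inv_le_lintegral_ray hloc hzero (continuous_rotArea n).measurable hρ
    (fun r hr ↦ rotArea_pos n (hρ.trans hr)) (norm_eq_of_mem_sphere θ) hθ hr₀ (h1 _ hr₀F)).trans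
      (lintegral_mono_set (Ioi_subset_Ioi hρ.le))

lemma cap_rotMetric_pos {n : ℕ} (hn : 2 ≤ n) {F : Set (EuclideanSpace ℝ (Fin n))}
    (hF : IsCompact F) (hvol : 0 < (rotMetric n).vol F) : 0 < (rotMetric n).cap F univ := by
  have : Nonempty (Fin n) := ⟨⟨0, by lia⟩⟩
  have hF0 : volume F ≠ 0 := by
    intro h0
    rw [vol_rotMetric (by lia)] at hvol
    exact hvol.ne' (withDensity_absolutelyContinuous _ _ h0)
  -- The integral of `1 / f^(n-1)` diverges at the origin, so rays must start at a positive radius.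
  -- The sets `F \ ball 0 (1 / (k + 1))` exhaust `F` up to the origin, so one of them has positive
  -- volume.
  have hex : ∃ k : ℕ, volume (F \ Metric.ball 0 (1 / ((k : ℝ) + 1))) ≠ 0 := by
    by_contra! hall
    refine hF0 (measure_mono_null (t := {0} ∪ ⋃ k : ℕ, F \ Metric.ball 0 (1 / ((k : ℝ) + 1))) ?_
      (measure_union_null (measure_singleton _) (measure_iUnion_null hall)))
    intro x hx
    rcases eq_or_ne x 0 with rfl | hx0
    · exact Or.inl rfl
    · obtain ⟨k, hk⟩ := exists_nat_one_div_lt (norm_pos_iff.2 hx0)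
      exact Or.inr (mem_iUnion.2 ⟨k, hx, fun h ↦ hk.not_gt (mem_ball_zero_iff.1 h)⟩)
  obtain ⟨k, hk⟩ := hex
  have hρ : (0 : ℝ) < 1 / ((k : ℝ) + 1) := by positivity
  refine lt_of_lt_of_le (ENNReal.mul_pos ?_ ?_) (le_cap_rotMetric hn hF hρ)
  · exact ENNReal.inv_ne_zero.2 (lintegral_inv_rotArea_lt_top hn hρ).ne
  · exact fun h ↦ hk (volume_diff_ball_eq_zero (by lia) hF.measurableSet h)

lemma vol_rotMetric_ball_pos {n : ℕ} (hn : 1 ≤ n) :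
    0 < (rotMetric n).vol (Metric.closedBall 0 1) := by
  rw [vol_rotMetric hn, pos_iff_ne_zero]
  intro h
  rw [withDensity_apply_eq_zero (measurable_rotDensity n)] at h
  have hu : {x : EuclideanSpace ℝ (Fin n) |
      ENNReal.ofReal √(rotProfile n (‖x‖ ^ 2) ^ (n - 1)) ≠ 0} = univ := by
    refine eq_univ_of_forall fun x ↦ (ENNReal.ofReal_pos.2 ?_).ne'
    have := rotProfile_pos n (sq_nonneg ‖x‖)
    positivity
  rw [hu, univ_inter] at h
  exact (Metric.measure_closedBall_pos volume 0 one_pos).ne' h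

end

theorem mainTheorem7 (n : ℕ) (hn : 2 ≤ n) :
    ∃ g : SmoothMetric n,
      NoncompactSpace (EuclideanSpace ℝ (Fin n)) ∧ g.IsComplete ∧ g.IsRotationallySymmetric ∧
      (∀ F : Set (EuclideanSpace ℝ (Fin n)), IsCompact F → 0 < g.vol F → 0 < g.cap F univ) ∧
      (∀ t : ℝ, 0 < t → ∀ F : Set (EuclideanSpace ℝ (Fin n)), IsCompact F →
        g.capT t F univ = 0) ∧
      g.IsMParabolic ∧ ¬ g.IsParabolic := by
  have : Nonempty (Fin n) := ⟨⟨0, by lia⟩⟩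
  refine ⟨rotMetric n, NormedSpace.noncompactSpace ℝ _, isComplete_rotMetric n,
    isRotationallySymmetric_rotMetric n, fun F hF hvol ↦ cap_rotMetric_pos hn hF hvol,
    fun t ht F hF ↦ capT_rotMetric_eq_zero hn ht.le hF, ?_, ?_⟩
  · exact ⟨1, one_pos, Metric.closedBall 0 1, isCompact_closedBall 0 1,
      vol_rotMetric_ball_pos (by lia), capT_rotMetric_eq_zero hn zero_le_one
        (isCompact_closedBall 0 1)⟩
  · rintro ⟨K, hK, hvol, hcap⟩
    exact (cap_rotMetric_pos hn hK hvol).ne' hcap
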